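/- **Setting.** Let $S$ be one of the four resource monads with symmetric tensor product: linear, semicartesian, relevant or cartesian. For a category $C$, the objects of $SC$ are the finite lists $\langle a_1,\dots,a_k\rangle$ of objects of $C$, and a morphism $\langle a_1,\dots,a_n\rangle\to\langle b_1,\dots,b_m\rangle$ is a tuple $\langle\alpha,f_1,\dots,f_m\rangle$ where $\alpha:[m]\to[n]$ is a bijection (linear), an injection (semicartesian), a surjection (relevant), an arbitrary function (cartesian), and $f_i:a_{\alpha(i)}\to b_i$ in $C$; composition is $\langle\beta,\vec g\rangle\circ\langle\alpha,\vec f\rangle=\langle\alpha\circ\beta,(g_i\circ f_{\beta(i)})_i\rangle$. Concatenation of lists is a tensor product on $SC$, and $\otimes$ denotes the componentwise one on $(SC)^n$. Let $A$ be a non-empty small category. The category of types $D=D_A$ has as objects the types generated by $a::=o\in\mathrm{Ob}(A)\mid\langle a_1,\dots,a_k\rangle\Rightarrow a$. Its morphisms are the morphisms $o\to o'$ of $A$ between atoms, and the $\langle\alpha,\vec f\rangle\Rightarrow g:(\vec a\Rightarrow a)\to(\vec a'\Rightarrow a')$ with $\langle\alpha,\vec f\rangle:\vec a'\to\vec a$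 in $SD$ and $g:a\to a'$ in $D$. For a $\lambda$-term $M$ (up to renaming of bound variables) and a list $\vec x=\langle x_1,\dots,x_n\rangle$ of distinct variables containing the free variables of $M$, the intersection type distributor $\llbracket M\rrbracket_{\vec x}:D\nrightarrow SD^n$, i.e. functor $(SD^n)^{o}\times D\to\mathrm{Set}$, is defined by induction on $M$: - $\llbracket x_i\rrbracket_{\vec x}(\Delta,a)=SD^n(\Delta,\langle\langle\rangle,\dots,\langle a\rangle,\dots,\langle\rangle\rangle)$, with $\langle a\rangle$ in position $i$; - $\llbracket\lambda x.M\rrbracket_{\vec x}(\Delta,a)=\llbracket M\rrbracket_{\vec x\oplus\langle x\rangle}(\Delta\oplus\langle\vec a'\rangle,a')$ if $a=\vec a'\Rightarrow a'$, and $\emptyset$ if $a$ is an atom; - $\displaystyle\llbracket MN\rrbracket_{\vec x}(\Delta,a)=\int^{\vec a=\langle a_1,\dots,a_k\rangle\in SD}\int^{\Gamma_0,\dots,\Gamma_k\in SD^n}\llbracket M\rrbracket_{\vec x}(\Gamma_0,\vec a\Rightarrow a)\times\prod_{i=1}^k\llbracket N\rrbracket_{\vec x}(\Gamma_i,a_i)\times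 SD^n\Big(\Delta,\bigotimes_{i=0}^k\Gamma_i\Big).$ The zero distributor is the one all of whose values are empty. A head-normal form is a $\lambda$-term $\lambda x_1\dots\lambda x_m.\,x N_1\cdots N_k$ with $m,k\ge 0$. The head-reduct of a term is $H(M)=M$ if $M$ is a head-normal form, and $H(\lambda\vec x.(\lambda x.P)N N_1\cdots N_k)=\lambda\vec x.P[N/x]N_1\cdots N_k$ otherwise. The head-reduction of $M$ ends if $H^j(M)$ is a head-normal form for some $j\ge 0$. $M$ is head-normalizable if $M\to_\beta^* N$ for some head-normal form $N$. **Theorem.** For every such $S$ and $A$, every $\lambda$-term $M$ and every list $\vec x$ of distinct variables containing the free variables of $M$, the following statements are equivalent: 1. $\llbracket M\rrbracket_{\vec x}$ is not the zero distributor $D\nrightarrow SD^n$; 2. the head-reduction of $M$ ends; 3. $M$ is head-normalizable. -/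

import Mathlib

open CategoryTheory CategoryTheory.Limits Opposite

universe u v

namespace ITD

/-! ### Lambda-terms -/

/-- `Term n`: λ-terms up to renaming of bound variables, with free variables among a list
`x₁, …, xₙ` of `n` distinct variables (well-scoped de Bruijn terms). Inside an abstraction the
bound variable is the variable `0` and the other variables are shifted by one. -/
inductive Term : ℕ → Type
  | var {n : ℕ} (i : Fin n) : Term n
  | lam {n : ℕ} (M : Term (n + 1)) : Term n
  | app {n : ℕ} (M N : Term n) : Term n

namespace Term

/-- Renaming of the free variables. -/
def rename : {n m : ℕ} → (Fin n → Fin m) → Term n → Term m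
  | _, _, ρ, var i => var (ρ i)
  | _, _, ρ, lam M => lam (rename (Fin.cases 0 fun i => (ρ i).succ) M)
  | _, _, ρ, app M N => app (rename ρ M) (rename ρ N)

/-- Capture-free parallel substitution of the free variables. -/
def subst : {n m : ℕ} → (Fin n → Term m) → Term n → Term m
  | _, _, σ, var i => σ i
  | _, _, σ, lam M => lam (subst (Fin.cases (var 0) fun i => rename Fin.succ (σ i)) M)
  | _, _, σ, app M N => app (subst σ M) (subst σ N)

/-- `M[N/x]`, where `x` is the variable `0` of `M`. -/
def inst {n : ℕ} (M : Term (n + 1)) (N : Term n) : Term n :=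
  subst (Fin.cases N var) M

/-- `λ x₁ … λ xₘ. M`. -/
def lams {n : ℕ} : (m : ℕ) → Term (n + m) → Term n
  | 0, M => M
  | m + 1, M => lams m (lam M)

/-- `M N₁ ⋯ Nₖ`. -/
def apps {n : ℕ} (M : Term n) (Ns : List (Term n)) : Term n :=
  Ns.foldl app M

/-- One-step β-reduction, in any context. -/
inductive Beta : {n : ℕ} → Term n → Term n → Prop
  | beta {n : ℕ} (M : Term (n + 1)) (N : Term n) : Beta (app (lam M) N) (inst M N)
  | lam {n : ℕ} {M M' : Term (n + 1)} : Beta M M' → Beta (lam M) (lam M')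
  | appLeft {n : ℕ} {M M' : Term n} (N : Term n) : Beta M M' → Beta (app M N) (app M' N)
  | appRight {n : ℕ} (M : Term n) {N N' : Term n} : Beta N N' → Beta (app M N) (app M N')

/-- Head-normal forms `λ x₁ … λ xₘ. x N₁ ⋯ Nₖ`. -/
def IsHeadNormal {n : ℕ} (M : Term n) : Prop :=
  ∃ (m : ℕ) (x : Fin (n + m)) (Ns : List (Term (n + m))), M = lams m (apps (var x) Ns)

/-- The head-reduct `H(M)`; see `headReduct_headNormal` and `headReduct_redex`, which say that it
is given by the usual case distinction on the shape of `M`. -/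
def headReduct : {n : ℕ} → Term n → Term n
  | _, var i => var i
  | _, lam M => lam (headReduct M)
  | _, app (lam P) N => inst P N
  | _, app (var i) N => app (headReduct (var i)) N
  | _, app (app P Q) N => app (headReduct (app P Q)) N

theorem headReduct_lams {n : ℕ} (m : ℕ) (M : Term (n + m)) :
    headReduct (lams m M) = lams m (headReduct M) := by
  induction m with
  | zero => rfl
  | succ m ih => rw [lams, ih, headReduct]; rfl

theorem headReduct_apps_app {n : ℕ} (P Q : Term n) (Ns : List (Term n)) :
    headReduct (apps (app P Q) Ns) = apps (headReduct (app P Q)) Ns := by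
  induction Ns using List.reverseRecOn with
  | nil => rfl
  | append_singleton Ns N ih =>
    have h : ∃ P' Q', apps (app P Q) Ns = app P' Q' := by
      rcases List.eq_nil_or_concat Ns with rfl | ⟨L, b, rfl⟩
      · exact ⟨_, _, rfl⟩
      · exact ⟨apps (app P Q) L, b, by simp [apps]⟩
    obtain ⟨P', Q', h⟩ := h
    have e : ∀ X : Term n, apps X (Ns ++ [N]) = app (apps X Ns) N := by simp [apps]
    rw [e, e, ← ih, h, headReduct]

/-- `H(M) = M` if `M = λ x₁ … λ xₘ. x N₁ ⋯ Nₖ`. -/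
theorem headReduct_headNormal {n : ℕ} {M : Term n} (hM : IsHeadNormal M) : headReduct M = M := by
  obtain ⟨m, x, Ns, rfl⟩ := hM
  rw [headReduct_lams]
  congr 1
  cases Ns with
  | nil => rfl
  | cons N Ns =>
    change headReduct (apps (app (var x) N) Ns) = apps (app (var x) N) Ns
    rw [headReduct_apps_app, headReduct, headReduct]

/-- `H(λ x₁ … λ xₘ. (λ x. P) N N₁ ⋯ Nₖ) = λ x₁ … λ xₘ. P[N/x] N₁ ⋯ Nₖ`. -/
theorem headReduct_redex {n : ℕ} (m : ℕ) (P : Term (n + m + 1)) (N : Term (n + m))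
    (Ns : List (Term (n + m))) :
    headReduct (lams m (apps (app (lam P) N) Ns)) = lams m (apps (inst P N) Ns) := by
  rw [headReduct_lams, headReduct_apps_app, headReduct]

/-- The head-reduction `M, H(M), H(H(M)), …` of `M` ends: it reaches a head-normal form. -/
def HeadReductionEnds {n : ℕ} (M : Term n) : Prop :=
  ∃ k : ℕ, IsHeadNormal (headReduct^[k] M)

/-- `M` is head-normalizable: it β-reduces to some head-normal form. -/
def HeadNormalizable {n : ℕ} (M : Term n) : Prop :=
  ∃ N : Term n, Relation.ReflTransGen Beta M N ∧ IsHeadNormal N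

end Term

/-! ### Resource monads -/

/-- The resource monads `S` with symmetric tensor: `S C` is the free symmetric strict monoidal
(linear), semicartesian strict monoidal, relevant strict monoidal, cartesian strict monoidal
category on `C`. -/
inductive ResourceMonad
  | linear
  | semicartesian
  | relevant
  | cartesian

/-- The functions between indices that are allowed in the morphisms of `S C`. -/
def ResourceMonad.Adm {X Y : Type} : ResourceMonad → (X → Y) → Prop
  | linear, α => Function.Bijective α
  | semicartesian, α => Function.Injective α
  | relevant, α => Function.Surjective α
  | cartesian, _ => True

section Resources

variable {S : ResourceMonad}

theorem ResourceMonad.Adm.of_bijective {X Y : Type} {α : X → Y} (h : Function.Bijective α) :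
    S.Adm α := by
  cases S
  exacts [h, h.1, h.2, trivial]

theorem ResourceMonad.Adm.id {X : Type} : S.Adm (fun x : X => x) :=
  .of_bijective Function.bijective_id

theorem ResourceMonad.Adm.comp {X Y Z : Type} {α : Y → Z} {β : X → Y} (hα : S.Adm α)
    (hβ : S.Adm β) : S.Adm (fun x => α (β x)) := by
  cases S
  exacts [Function.Bijective.comp hα hβ, Function.Injective.comp hα hβ,
    Function.Surjective.comp hα hβ, trivial]

theorem ResourceMonad.Adm.sumMap {X Y X' Y' : Type} {α : X → Y} {β : X' → Y'} (hα : S.Adm α)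
    (hβ : S.Adm β) : S.Adm (Sum.map α β) := by
  cases S
  exacts [⟨hα.1.sumMap hβ.1, hα.2.sumMap hβ.2⟩, Function.Injective.sumMap hα hβ,
    Function.Surjective.sumMap hα hβ, trivial]

theorem ResourceMonad.Adm.sigmaMap {I J : Type} {X : I → Type} {Y : J → Type} {α : J → I}
    {β : ∀ j, Y j → X (α j)} (hα : S.Adm α) (hβ : ∀ j, S.Adm (β j)) :
    S.Adm (Sigma.map α β) := by
  cases S
  exacts [⟨hα.1.sigma_map fun j => (hβ j).1, hα.2.sigma_map fun j => (hβ j).2⟩,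
    Function.Injective.sigma_map hα hβ, Function.Surjective.sigma_map hα hβ, trivial]

end Resources

/-- Families of objects of `C`, an auxiliary notion: lists are the families indexed by `Fin k`. -/
structure Fam (S : ResourceMonad) (C : Type u) where
  idx : Type
  get : idx → C

/-- A morphism `⟨α, f⟩ : a → b` of families: an allowed function `α` from the indices of `b` to
the indices of `a`, with morphisms `f i : a (α i) ⟶ b i`. -/
structure Fam.Hom {S : ResourceMonad} {C : Type u} [Category.{v} C] (a b : Fam S C) where
  fn : b.idx → a.idx
  adm : S.Adm fn
  f : ∀ i, a.get (fn i) ⟶ b.get i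

instance {S : ResourceMonad} {C : Type u} [Category.{v} C] : Category.{v} (Fam S C) where
  Hom := Fam.Hom
  id a := ⟨fun i => i, .id, fun i => 𝟙 (a.get i)⟩
  comp p q := ⟨fun i => p.fn (q.fn i), p.adm.comp q.adm, fun i => p.f (q.fn i) ≫ q.f i⟩

theorem Fam.hom_ext' {S : ResourceMonad} {C : Type u} [Category.{v} C] {a b : Fam S C}
    {p q : a ⟶ b} (h : p.fn = q.fn)
    (e : ∀ i, p.f i = eqToHom (congrArg a.get (congrFun h i)) ≫ q.f i) : p = q := by
  obtain ⟨fn, _, f⟩ := p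
  obtain ⟨fn', _, f'⟩ := q
  obtain rfl : fn = fn' := h
  obtain rfl : f = f' := funext fun i => (e i).trans (Category.id_comp _)
  rfl

/-- The objects of `S C`: lists `⟨a₁, …, aₖ⟩` of objects of `C`. -/
structure ResList (S : ResourceMonad) (C : Type u) where
  len : ℕ
  get : Fin len → C

/-- A list as a family. -/
abbrev ResList.toFam {S : ResourceMonad} {C : Type u} (a : ResList S C) : Fam S C :=
  ⟨Fin a.len, a.get⟩

/-- The category `S C`: the morphisms `a → b` are the `⟨α, f₁, …, fₘ⟩` with
`α : [m] → [n]` allowed by `S` and `fᵢ : a_{α(i)} ⟶ bᵢ`, where `n = a.len`, `m = b.len`. -/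
instance {S : ResourceMonad} {C : Type u} [Category.{v} C] : Category.{v} (ResList S C) where
  Hom a b := a.toFam ⟶ b.toFam
  id a := 𝟙 a.toFam
  comp {a _ c} p q := (p ≫ q : a.toFam ⟶ c.toFam)
  id_comp {a b} p := Category.id_comp (X := a.toFam) (Y := b.toFam) p
  comp_id {a b} p := Category.comp_id (X := a.toFam) (Y := b.toFam) p
  assoc {a b c d} p q r := Category.assoc (W := a.toFam) (X := b.toFam) (Y := c.toFam)
    (Z := d.toFam) p q r

/-! ### The category of types -/

/-- Types over the atoms `A`: `a ::= o ∈ A | ⟨a₁, …, aₖ⟩ ⇒ a`. -/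
inductive Ty (S : ResourceMonad) (A : Type u) : Type u
  | atom (o : A) : Ty S A
  | arr (k : ℕ) (as : Fin k → Ty S A) (a : Ty S A) : Ty S A

namespace Ty

variable {S : ResourceMonad} {A : Type u} [SmallCategory A]

/-- Morphisms of types: morphisms of atoms `f : o ⟶ o'`, and
`⟨α, f₁, …, fₖ⟩ ⇒ g : (as ⇒ a) → (as' ⇒ a')` for `⟨α, f₁, …, fₖ⟩ : as' → as` and `g : a → a'`. -/
inductive Hom : Ty S A → Ty S A → Type u
  | atom {o o' : A} (f : o ⟶ o') : Hom (.atom o) (.atom o')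
  | arr {k k' : ℕ} {as : Fin k → Ty S A} {as' : Fin k' → Ty S A} {a a' : Ty S A}
      (α : Fin k → Fin k') (hα : S.Adm α) (f : ∀ i, Hom (as' (α i)) (as i)) (g : Hom a a') :
      Hom (.arr k as a) (.arr k' as' a')

/-- Identities. -/
def Hom.id : (a : Ty S A) → Hom a a
  | .atom o => .atom (𝟙 o)
  | .arr _ as a => .arr (fun i => i) .id (fun i => Hom.id (as i)) (Hom.id a)

/-- Composition, by recursion on the middle type. -/
def Hom.comp {a c : Ty S A} : (b : Ty S A) → Hom a b → Hom b c → Hom a c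
  | .atom _, .atom f, .atom g => .atom (f ≫ g)
  | .arr _ bs b, .arr α hα f g, .arr β hβ f' g' =>
      .arr (fun i => β (α i)) (hβ.comp hα) (fun i => Hom.comp (bs (α i)) (f' (α i)) (f i))
        (Hom.comp b g g')

theorem Hom.id_comp_and_comp_id {a b : Ty S A} (h : Hom a b) :
    Hom.comp a (Hom.id a) h = h ∧ Hom.comp b h (Hom.id b) = h := by
  induction h with
  | atom f => simp [Hom.id, Hom.comp]
  | arr α hα f g ihf ihg => simp [Hom.id, Hom.comp, ihf, ihg]

theorem Hom.assoc {b c : Ty S A} (h : Hom b c) : ∀ {a d : Ty S A} (p : Hom a b) (q : Hom c d),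
    Hom.comp c (Hom.comp b p h) q = Hom.comp b p (Hom.comp c h q) := by
  induction h with
  | atom f =>
    rintro a d ⟨p⟩ ⟨q⟩
    simp [Hom.comp]
  | arr α hα f g ihf ihg =>
    intro a d p q
    cases p
    cases q
    simp [Hom.comp, ihf, ihg]

/-- The category `D` of types. -/
instance : SmallCategory (Ty S A) where
  Hom := Hom
  id := Hom.id
  comp := Hom.comp _
  id_comp h := h.id_comp_and_comp_id.1
  comp_id h := h.id_comp_and_comp_id.2
  assoc p h q := Hom.assoc h p q

/-- The functor `ι : (S D)ᵒᵖ × D ⥤ D` sending `(⟨a₁, …, aₖ⟩, a)` to `⟨a₁, …, aₖ⟩ ⇒ a`. -/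
def arrow : (ResList S (Ty S A))ᵒᵖ × Ty S A ⥤ Ty S A where
  obj p := .arr p.1.unop.len p.1.unop.get p.2
  map p := .arr p.1.unop.fn p.1.unop.adm p.1.unop.f p.2

end Ty

/-! ### Type contexts and their tensor product -/

section Contexts

variable {S : ResourceMonad} {C : Type u} [Category.{v} C]

/-- The disjoint union of a family and of finitely many families. -/
def Fam.tens {k : ℕ} (a₀ : Fam S C) (a : Fin k → Fam S C) : Fam S C :=
  ⟨a₀.idx ⊕ (Σ i, (a i).idx), Sum.elim a₀.get fun x => (a x.1).get x.2⟩

/-- `a₀ ⊗ a₁ ⊗ … ⊗ aₖ → b₀ ⊗ b₁ ⊗ … ⊗ bₗ` induced by an allowed `α : [l] → [k]` and by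
`p₀ : a₀ → b₀` and `pⱼ : a_{α(j)} → bⱼ`. -/
def Fam.tensMap {k l : ℕ} {a₀ b₀ : Fam S C} {a : Fin k → Fam S C} {b : Fin l → Fam S C}
    (p₀ : a₀ ⟶ b₀) (α : Fin l → Fin k) (hα : S.Adm α) (p : ∀ j, a (α j) ⟶ b j) :
    Fam.tens a₀ a ⟶ Fam.tens b₀ b where
  fn := Sum.map p₀.fn (Sigma.map α fun j => (p j).fn)
  adm := p₀.adm.sumMap (hα.sigmaMap fun j => (p j).adm)
  f
    | .inl i => p₀.f i
    | .inr x => (p x.1).f x.2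

theorem Fam.tensMap_id {k : ℕ} (a₀ : Fam S C) (a : Fin k → Fam S C) :
    Fam.tensMap (𝟙 a₀) (fun i => i) .id (fun i => 𝟙 (a i)) = 𝟙 (Fam.tens a₀ a) := by
  refine Fam.hom_ext' (funext ?_) ?_
  · rintro (i | x) <;> rfl
  · rintro (i | x) <;> exact (Category.id_comp _).symm

theorem Fam.tensMap_comp {k l m : ℕ} {a₀ b₀ c₀ : Fam S C} {a : Fin k → Fam S C}
    {b : Fin l → Fam S C} {c : Fin m → Fam S C}
    (p₀ : a₀ ⟶ b₀) (α : Fin l → Fin k) (hα : S.Adm α) (p : ∀ j, a (α j) ⟶ b j)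
    (q₀ : b₀ ⟶ c₀) (β : Fin m → Fin l) (hβ : S.Adm β) (q : ∀ j, b (β j) ⟶ c j) :
    Fam.tensMap p₀ α hα p ≫ Fam.tensMap q₀ β hβ q =
      Fam.tensMap (p₀ ≫ q₀) (fun j => α (β j)) (hα.comp hβ) (fun j => p (β j) ≫ q j) := by
  refine Fam.hom_ext' (funext ?_) ?_
  · rintro (i | x) <;> rfl
  · rintro (i | x) <;> exact (Category.id_comp _).symm

namespace ResList

/-- `[n₀] ⊔ [n₁] ⊔ … ⊔ [nₖ] ≃ [n₀ + (n₁ + … + nₖ)]`, in the lexicographic order. -/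
def tensEquiv {k : ℕ} (n₀ : ℕ) (n : Fin k → ℕ) :
    (Fin n₀ ⊕ (Σ i, Fin (n i))) ≃ Fin (n₀ + ∑ i, n i) :=
  (Equiv.sumCongr (Equiv.refl _) finSigmaFinEquiv).trans finSumFinEquiv

/-- The concatenation `a₀ ⊗ a₁ ⊗ … ⊗ aₖ` of lists. -/
def tens {k : ℕ} (a₀ : ResList S C) (a : Fin k → ResList S C) : ResList S C where
  len := a₀.len + ∑ i, (a i).len
  get i := (Fam.tens a₀.toFam fun i => (a i).toFam).get
    ((tensEquiv a₀.len fun i => (a i).len).symm i)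

/-- The enumeration of the concatenation of lists. -/
def tensIso {k : ℕ} (a₀ : ResList S C) (a : Fin k → ResList S C) :
    (tens a₀ a).toFam ≅ Fam.tens a₀.toFam fun i => (a i).toFam where
  hom := ⟨tensEquiv a₀.len fun i => (a i).len, .of_bijective (Equiv.bijective _),
    fun i => eqToHom (congrArg _ (Equiv.symm_apply_apply _ i))⟩
  inv := ⟨(tensEquiv a₀.len fun i => (a i).len).symm, .of_bijective (Equiv.bijective _),
    fun i => 𝟙 _⟩
  hom_inv_id := by
    refine Fam.hom_ext' (funext fun i => Equiv.apply_symm_apply _ i) fun i => ?_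
    exact (Category.comp_id _).trans (Category.comp_id _).symm
  inv_hom_id := by
    refine Fam.hom_ext' (funext fun i => Equiv.symm_apply_apply _ i) fun i => ?_
    exact (Category.id_comp _).trans (Category.comp_id _).symm

/-- `a₀ ⊗ a₁ ⊗ … ⊗ aₖ → b₀ ⊗ b₁ ⊗ … ⊗ bₗ` induced by an allowed `α : [l] → [k]` and by
`p₀ : a₀ → b₀` and `pⱼ : a_{α(j)} → bⱼ`. For `α` the identity this is the tensor product of
morphisms, and for identities `pⱼ` it is `p₀ ⊗ α⋆`. -/
def tensMap {k l : ℕ} {a₀ b₀ : ResList S C} {a : Fin k → ResList S C} {b : Fin l → ResList S C}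
    (p₀ : a₀ ⟶ b₀) (α : Fin l → Fin k) (hα : S.Adm α) (p : ∀ j, a (α j) ⟶ b j) :
    tens a₀ a ⟶ tens b₀ b :=
  show (tens a₀ a).toFam ⟶ (tens b₀ b).toFam from
    (tensIso a₀ a).hom ≫ Fam.tensMap (a := fun i => (a i).toFam) (b := fun i => (b i).toFam)
      p₀ α hα p ≫ (tensIso b₀ b).inv

theorem tensMap_id {k : ℕ} (a₀ : ResList S C) (a : Fin k → ResList S C) :
    tensMap (𝟙 a₀) (fun i => i) .id (fun i => 𝟙 (a i)) = 𝟙 (tens a₀ a) := by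
  change (tensIso a₀ a).hom ≫ Fam.tensMap (𝟙 a₀.toFam) (fun i => i) .id
    (fun i => 𝟙 (a i).toFam) ≫ (tensIso a₀ a).inv = 𝟙 (tens a₀ a).toFam
  rw [Fam.tensMap_id, Category.id_comp, Iso.hom_inv_id]

theorem tensMap_comp {k l m : ℕ} {a₀ b₀ c₀ : ResList S C} {a : Fin k → ResList S C}
    {b : Fin l → ResList S C} {c : Fin m → ResList S C}
    (p₀ : a₀ ⟶ b₀) (α : Fin l → Fin k) (hα : S.Adm α) (p : ∀ j, a (α j) ⟶ b j)
    (q₀ : b₀ ⟶ c₀) (β : Fin m → Fin l) (hβ : S.Adm β) (q : ∀ j, b (β j) ⟶ c j) :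
    tensMap p₀ α hα p ≫ tensMap q₀ β hβ q =
      tensMap (p₀ ≫ q₀) (fun j => α (β j)) (hα.comp hβ) (fun j => p (β j) ≫ q j) := by
  change ((tensIso a₀ a).hom ≫ Fam.tensMap (a := fun i => (a i).toFam)
      (b := fun i => (b i).toFam) p₀ α hα p ≫ (tensIso b₀ b).inv) ≫
    ((tensIso b₀ b).hom ≫ Fam.tensMap (a := fun i => (b i).toFam)
      (b := fun i => (c i).toFam) q₀ β hβ q ≫ (tensIso c₀ c).inv) =
    (tensIso a₀ a).hom ≫ Fam.tensMap (a := fun i => (a i).toFam) (b := fun i => (c i).toFam)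
      (CategoryStruct.comp (X := a₀.toFam) (Y := b₀.toFam) (Z := c₀.toFam) p₀ q₀)
      (fun j => α (β j)) (hα.comp hβ)
      (fun j => CategoryStruct.comp (X := (a (α (β j))).toFam) (Y := (b (β j)).toFam)
        (Z := (c j).toFam) (p (β j)) (q j)) ≫ (tensIso c₀ c).inv
  rw [← Fam.tensMap_comp (a := fun i => (a i).toFam) (b := fun i => (b i).toFam)
    (c := fun i => (c i).toFam) (hα := hα) (hβ := hβ)]
  simp only [Category.assoc, Iso.inv_hom_id_assoc]

/-- The list consisting of `r` copies of `a`. -/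
def replicate (r : ℕ) : C ⥤ ResList S C where
  obj a := ⟨r, fun _ => a⟩
  map g := ⟨fun i => i, .id, fun _ => g⟩

end ResList

/-- `(S C)ⁿ`; for `C` the category of types, its objects are the type contexts. -/
abbrev Ctx (S : ResourceMonad) (C : Type u) (n : ℕ) : Type u := Fin n → ResList S C

namespace Ctx

variable {n : ℕ}

/-- The componentwise tensor product `Γ₀ ⊗ Γ₁ ⊗ … ⊗ Γₖ` of contexts. -/
def tens {k : ℕ} (Γ₀ : Ctx S C n) (Γ : Fin k → Ctx S C n) : Ctx S C n :=
  fun x => ResList.tens (Γ₀ x) fun i => Γ i x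

/-- The componentwise version of `ResList.tensMap`. -/
def tensMap {k l : ℕ} {Γ₀ Δ₀ : Ctx S C n} {Γ : Fin k → Ctx S C n} {Δ : Fin l → Ctx S C n}
    (p₀ : Γ₀ ⟶ Δ₀) (α : Fin l → Fin k) (hα : S.Adm α) (p : ∀ j, Γ (α j) ⟶ Δ j) :
    tens Γ₀ Γ ⟶ tens Δ₀ Δ :=
  fun x => ResList.tensMap (p₀ x) α hα fun j => p j x

theorem tensMap_id {k : ℕ} (Γ₀ : Ctx S C n) (Γ : Fin k → Ctx S C n) :
    tensMap (𝟙 Γ₀) (fun i => i) .id (fun i => 𝟙 (Γ i)) = 𝟙 (tens Γ₀ Γ) :=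
  funext fun _ => ResList.tensMap_id _ _

theorem tensMap_comp {k l m : ℕ} {Γ₀ Δ₀ Θ₀ : Ctx S C n} {Γ : Fin k → Ctx S C n}
    {Δ : Fin l → Ctx S C n} {Θ : Fin m → Ctx S C n}
    (p₀ : Γ₀ ⟶ Δ₀) (α : Fin l → Fin k) (hα : S.Adm α) (p : ∀ j, Γ (α j) ⟶ Δ j)
    (q₀ : Δ₀ ⟶ Θ₀) (β : Fin m → Fin l) (hβ : S.Adm β) (q : ∀ j, Δ (β j) ⟶ Θ j) :
    tensMap p₀ α hα p ≫ tensMap q₀ β hβ q =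
      tensMap (p₀ ≫ q₀) (fun j => α (β j)) (hα.comp hβ) (fun j => p (β j) ≫ q j) :=
  funext fun _ => ResList.tensMap_comp _ _ _ _ _ _ _ _

/-- The context `⟨⟨⟩, …, ⟨a⟩, …, ⟨⟩⟩`, with `⟨a⟩` in position `i`. -/
def single (i : Fin n) : C ⥤ Ctx S C n where
  obj a := fun x => (ResList.replicate (if x = i then 1 else 0)).obj a
  map g := fun x => (ResList.replicate (if x = i then 1 else 0)).map g

/-- The extension of a context `Δ` by a list of types for the variable `0`. -/
def cons : ResList S C × Ctx S C n ⥤ Ctx S C (n + 1) where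
  obj p := fun x => Fin.cases (motive := fun _ => ResList S C) p.1 p.2 x
  map f := fun x => Fin.cases f.1 f.2 x
  map_id p := funext fun x => by cases x using Fin.cases <;> rfl
  map_comp f g := funext fun x => by cases x using Fin.cases <;> rfl

end Ctx

end Contexts

/-! ### Day convolution -/

section Day

variable {S : ResourceMonad} {C : Type u} [SmallCategory C] {n : ℕ}

/-- The set `X₀(Γ₀) × ∏ᵢ Xᵢ(Γᵢ) × (S C)ⁿ(Δ, Γ'₀ ⊗ Γ'₁ ⊗ … ⊗ Γ'ₖ)`. -/
structure DayElt {k : ℕ} (X₀ : (Ctx S C n)ᵒᵖ ⥤ Type u) (X : Fin k → (Ctx S C n)ᵒᵖ ⥤ Type u)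
    (Δ : Ctx S C n) (Γ Γ' : Ctx S C n × (Fin k → Ctx S C n)) : Type u where
  fn : X₀.obj (op Γ.1)
  arg : ∀ i, (X i).obj (op (Γ.2 i))
  mor : Δ ⟶ Ctx.tens Γ'.1 Γ'.2

theorem DayElt.ext' {k : ℕ} {X₀ : (Ctx S C n)ᵒᵖ ⥤ Type u}
    {X : Fin k → (Ctx S C n)ᵒᵖ ⥤ Type u} {Δ : Ctx S C n}
    {Γ Γ' : Ctx S C n × (Fin k → Ctx S C n)} {z w : DayElt X₀ X Δ Γ Γ'} (h₁ : z.fn = w.fn)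
    (h₂ : ∀ i, z.arg i = w.arg i) (h₃ : z.mor = w.mor) : z = w := by
  obtain ⟨a, b, c⟩ := z
  obtain ⟨a', b', c'⟩ := w
  obtain rfl : a = a' := h₁
  obtain rfl : b = b' := funext h₂
  obtain rfl : c = c' := h₃
  rfl

namespace DayElt

variable {k : ℕ} {X₀ : (Ctx S C n)ᵒᵖ ⥤ Type u} {X : Fin k → (Ctx S C n)ᵒᵖ ⥤ Type u}
  {Δ : Ctx S C n}

/-- Covariant action on the third factor. -/
def push {Γ Γ' Γ'' : Ctx S C n × (Fin k → Ctx S C n)} (p : Γ' ⟶ Γ'') (z : DayElt X₀ X Δ Γ Γ') :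
    DayElt X₀ X Δ Γ Γ'' :=
  ⟨z.fn, z.arg, z.mor ≫ Ctx.tensMap p.1 (fun i => i) .id p.2⟩

/-- Contravariant action on the first two factors. -/
def pull {Γ Γ' Γ'' : Ctx S C n × (Fin k → Ctx S C n)} (q : Γ'' ⟶ Γ) (z : DayElt X₀ X Δ Γ Γ') :
    DayElt X₀ X Δ Γ'' Γ' :=
  ⟨X₀.map q.1.op z.fn, fun i => (X i).map (q.2 i).op (z.arg i), z.mor⟩

theorem push_id {Γ Γ' : Ctx S C n × (Fin k → Ctx S C n)} (z : DayElt X₀ X Δ Γ Γ') :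
    z.push (𝟙 Γ') = z := by
  refine ext' rfl (fun _ => rfl) ?_
  change z.mor ≫ Ctx.tensMap (𝟙 Γ'.1) (fun i => i) .id (fun i => 𝟙 (Γ'.2 i)) = z.mor
  rw [Ctx.tensMap_id, Category.comp_id]

theorem push_comp {Γ Γ₁ Γ₂ Γ₃ : Ctx S C n × (Fin k → Ctx S C n)} (p : Γ₁ ⟶ Γ₂) (q : Γ₂ ⟶ Γ₃)
    (z : DayElt X₀ X Δ Γ Γ₁) : z.push (p ≫ q) = (z.push p).push q := by
  refine ext' rfl (fun _ => rfl) ?_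
  change z.mor ≫ Ctx.tensMap (p.1 ≫ q.1) (fun i => i) .id (fun i => p.2 i ≫ q.2 i) =
    (z.mor ≫ Ctx.tensMap p.1 (fun i => i) .id p.2) ≫ Ctx.tensMap q.1 (fun i => i) .id q.2
  rw [Category.assoc, Ctx.tensMap_comp]

theorem pull_id {Γ Γ' : Ctx S C n × (Fin k → Ctx S C n)} (z : DayElt X₀ X Δ Γ Γ') :
    z.pull (𝟙 Γ) = z := by
  refine ext' ?_ (fun i => ?_) rfl
  · exact Functor.map_id_apply X₀ _ z.fn
  · exact Functor.map_id_apply (X i) _ (z.arg i)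

theorem pull_comp {Γ' Γ₁ Γ₂ Γ₃ : Ctx S C n × (Fin k → Ctx S C n)} (p : Γ₁ ⟶ Γ₂) (q : Γ₂ ⟶ Γ₃)
    (z : DayElt X₀ X Δ Γ₃ Γ') : z.pull (p ≫ q) = (z.pull q).pull p := by
  refine ext' ?_ (fun i => ?_) rfl
  · exact Functor.map_comp_apply X₀ q.1.op p.1.op z.fn
  · exact Functor.map_comp_apply (X i) (q.2 i).op (p.2 i).op (z.arg i)

end DayElt

/-- The integrand `X₀(Γ₀) × ∏ᵢ Xᵢ(Γᵢ) × (S C)ⁿ(Δ, Γ'₀ ⊗ Γ'₁ ⊗ … ⊗ Γ'ₖ)`, contravariant in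
`(Γ₀, (Γᵢ)ᵢ)` and covariant in `(Γ'₀, (Γ'ᵢ)ᵢ)`. -/
def dayIntegrand {k : ℕ} (X₀ : (Ctx S C n)ᵒᵖ ⥤ Type u) (X : Fin k → (Ctx S C n)ᵒᵖ ⥤ Type u)
    (Δ : Ctx S C n) :
    (Ctx S C n × (Fin k → Ctx S C n))ᵒᵖ ⥤ Ctx S C n × (Fin k → Ctx S C n) ⥤ Type u where
  obj Γ :=
    { obj := fun Γ' => DayElt X₀ X Δ Γ.unop Γ'
      map := fun p => ↾fun z => z.push p
      map_id := fun _ => congrArg TypeCat.ofHom (funext DayElt.push_id)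
      map_comp := fun p q => congrArg TypeCat.ofHom (funext (DayElt.push_comp p q)) }
  map q :=
    { app := fun _ => ↾fun z => z.pull q.unop
      naturality := fun _ _ _ => rfl }
  map_id _ := NatTrans.ext (funext fun _ => congrArg TypeCat.ofHom (funext DayElt.pull_id))
  map_comp p q := NatTrans.ext (funext fun _ =>
    congrArg TypeCat.ofHom (funext (DayElt.pull_comp q.unop p.unop)))

/-- The value at `Δ` of the Day convolution `X₀ ⊗̂ X₁ ⊗̂ … ⊗̂ Xₖ` of presheaves:
`∫^{Γ₀, …, Γₖ} X₀(Γ₀) × ∏ᵢ Xᵢ(Γᵢ) × (S C)ⁿ(Δ, Γ₀ ⊗ Γ₁ ⊗ … ⊗ Γₖ)`. -/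
noncomputable abbrev day {k : ℕ} (X₀ : (Ctx S C n)ᵒᵖ ⥤ Type u)
    (X : Fin k → (Ctx S C n)ᵒᵖ ⥤ Type u) (Δ : Ctx S C n) : Type u :=
  coend (dayIntegrand X₀ X Δ)

/-- The action of `t₀ : X₀ ⟶ Y₀`, of an allowed `α : [l] → [k]`, of `tⱼ : X_{α(j)} ⟶ Yⱼ` and of
`η : Δ' ⟶ Δ` on integrands. -/
def DayElt.act {k l : ℕ} {X₀ Y₀ : (Ctx S C n)ᵒᵖ ⥤ Type u}
    {X : Fin k → (Ctx S C n)ᵒᵖ ⥤ Type u} {Y : Fin l → (Ctx S C n)ᵒᵖ ⥤ Type u}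
    {Δ Δ' : Ctx S C n} (t₀ : X₀ ⟶ Y₀) (α : Fin l → Fin k) (hα : S.Adm α)
    (t : ∀ j, X (α j) ⟶ Y j) (η : Δ' ⟶ Δ) {Γ Γ' : Ctx S C n × (Fin k → Ctx S C n)}
    (z : DayElt X₀ X Δ Γ Γ') :
    DayElt Y₀ Y Δ' (Γ.1, fun j => Γ.2 (α j)) (Γ'.1, fun j => Γ'.2 (α j)) :=
  ⟨t₀.app _ z.fn, fun j => (t j).app _ (z.arg (α j)),
    η ≫ z.mor ≫ Ctx.tensMap (𝟙 Γ'.1) α hα fun j => 𝟙 (Γ'.2 (α j))⟩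

theorem DayElt.act_pull {k l : ℕ} {X₀ Y₀ : (Ctx S C n)ᵒᵖ ⥤ Type u}
    {X : Fin k → (Ctx S C n)ᵒᵖ ⥤ Type u} {Y : Fin l → (Ctx S C n)ᵒᵖ ⥤ Type u}
    {Δ Δ' : Ctx S C n} (t₀ : X₀ ⟶ Y₀) (α : Fin l → Fin k) (hα : S.Adm α)
    (t : ∀ j, X (α j) ⟶ Y j) (η : Δ' ⟶ Δ) {Γ Γ' Γ'' : Ctx S C n × (Fin k → Ctx S C n)}
    (p : Γ'' ⟶ Γ) (z : DayElt X₀ X Δ Γ Γ') :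
    (z.pull p).act t₀ α hα t η = (z.act t₀ α hα t η).pull
      (Γ'' := (Γ''.1, fun j => Γ''.2 (α j))) (p.1, fun j => p.2 (α j)) := by
  refine DayElt.ext' ?_ (fun j => ?_) rfl
  · exact NatTrans.naturality_apply t₀ p.1.op z.fn
  · exact NatTrans.naturality_apply (t j) (p.2 (α j)).op (z.arg (α j))

theorem DayElt.act_push {k l : ℕ} {X₀ Y₀ : (Ctx S C n)ᵒᵖ ⥤ Type u}
    {X : Fin k → (Ctx S C n)ᵒᵖ ⥤ Type u} {Y : Fin l → (Ctx S C n)ᵒᵖ ⥤ Type u}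
    {Δ Δ' : Ctx S C n} (t₀ : X₀ ⟶ Y₀) (α : Fin l → Fin k) (hα : S.Adm α)
    (t : ∀ j, X (α j) ⟶ Y j) (η : Δ' ⟶ Δ) {Γ Γ' Γ'' : Ctx S C n × (Fin k → Ctx S C n)}
    (p : Γ' ⟶ Γ'') (z : DayElt X₀ X Δ Γ Γ') :
    (z.push p).act t₀ α hα t η = (z.act t₀ α hα t η).push
      (Γ'' := (Γ''.1, fun j => Γ''.2 (α j))) (p.1, fun j => p.2 (α j)) := by
  refine DayElt.ext' rfl (fun _ => rfl) ?_
  change η ≫ (z.mor ≫ Ctx.tensMap p.1 (fun i => i) .id p.2) ≫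
      Ctx.tensMap (𝟙 Γ''.1) α hα (fun j => 𝟙 (Γ''.2 (α j))) =
    (η ≫ z.mor ≫ Ctx.tensMap (𝟙 Γ'.1) α hα (fun j => 𝟙 (Γ'.2 (α j)))) ≫
      Ctx.tensMap p.1 (fun i => i) .id fun j => p.2 (α j)
  simp only [Category.assoc, Ctx.tensMap_comp, Category.id_comp, Category.comp_id]

/-- The map between Day convolutions induced by `t₀ : X₀ ⟶ Y₀`, an allowed `α : [l] → [k]`,
`tⱼ : X_{α(j)} ⟶ Yⱼ` and `η : Δ' ⟶ Δ`. -/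
noncomputable def dayMap {k l : ℕ} {X₀ Y₀ : (Ctx S C n)ᵒᵖ ⥤ Type u}
    {X : Fin k → (Ctx S C n)ᵒᵖ ⥤ Type u} {Y : Fin l → (Ctx S C n)ᵒᵖ ⥤ Type u}
    {Δ Δ' : Ctx S C n} (t₀ : X₀ ⟶ Y₀) (α : Fin l → Fin k) (hα : S.Adm α)
    (t : ∀ j, X (α j) ⟶ Y j) (η : Δ' ⟶ Δ) : day X₀ X Δ ⟶ day Y₀ Y Δ' :=
  coend.desc (F := dayIntegrand X₀ X Δ)
    (fun Γ => (↾fun z : DayElt X₀ X Δ Γ Γ => z.act t₀ α hα t η) ≫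
      coend.ι (dayIntegrand Y₀ Y Δ') (Γ.1, fun j => Γ.2 (α j)))
    (fun Γ Γ' p => by
      have h := coend.condition (dayIntegrand Y₀ Y Δ') (i := (Γ.1, fun j => Γ.2 (α j)))
        (j := (Γ'.1, fun j => Γ'.2 (α j))) (p.1, fun j => p.2 (α j))
      refine ConcreteCategory.hom_ext _ _ fun (z : DayElt X₀ X Δ Γ' Γ) => ?_
      change coend.ι (dayIntegrand Y₀ Y Δ') (Γ.1, fun j => Γ.2 (α j))
          ((z.pull p).act t₀ α hα t η) =
        coend.ι (dayIntegrand Y₀ Y Δ') (Γ'.1, fun j => Γ'.2 (α j))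
          ((z.push p).act t₀ α hα t η)
      rw [DayElt.act_pull, DayElt.act_push]
      exact ConcreteCategory.congr_hom h (z.act t₀ α hα t η))

theorem dayMap_ι {k l : ℕ} {X₀ Y₀ : (Ctx S C n)ᵒᵖ ⥤ Type u}
    {X : Fin k → (Ctx S C n)ᵒᵖ ⥤ Type u} {Y : Fin l → (Ctx S C n)ᵒᵖ ⥤ Type u}
    {Δ Δ' : Ctx S C n} (t₀ : X₀ ⟶ Y₀) (α : Fin l → Fin k) (hα : S.Adm α)
    (t : ∀ j, X (α j) ⟶ Y j) (η : Δ' ⟶ Δ) (Γ : Ctx S C n × (Fin k → Ctx S C n))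
    (z : DayElt X₀ X Δ Γ Γ) :
    dayMap t₀ α hα t η (coend.ι (dayIntegrand X₀ X Δ) Γ z) =
      coend.ι (dayIntegrand Y₀ Y Δ') (Γ.1, fun j => Γ.2 (α j)) (z.act t₀ α hα t η) :=
  ConcreteCategory.congr_hom (coend.ι_desc (F := dayIntegrand X₀ X Δ) _ _ Γ) z

/-- Maps out of a Day convolution are equal if they agree on representatives. -/
theorem day_hom_ext {k : ℕ} {X₀ : (Ctx S C n)ᵒᵖ ⥤ Type u}
    {X : Fin k → (Ctx S C n)ᵒᵖ ⥤ Type u} {Δ : Ctx S C n} {T : Type u} {f g : day X₀ X Δ ⟶ T}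
    (h : ∀ Γ (z : DayElt X₀ X Δ Γ Γ), f (coend.ι (dayIntegrand X₀ X Δ) Γ z) =
      g (coend.ι (dayIntegrand X₀ X Δ) Γ z)) : f = g :=
  coend.hom_ext fun Γ => ConcreteCategory.hom_ext _ _ (h Γ)

theorem dayMap_congr {k l : ℕ} {X₀ Y₀ : (Ctx S C n)ᵒᵖ ⥤ Type u}
    {X : Fin k → (Ctx S C n)ᵒᵖ ⥤ Type u} {Y : Fin l → (Ctx S C n)ᵒᵖ ⥤ Type u}
    {Δ Δ' : Ctx S C n} {t₀ t₀' : X₀ ⟶ Y₀} {α : Fin l → Fin k} {hα hα' : S.Adm α}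
    {t t' : ∀ j, X (α j) ⟶ Y j} {η η' : Δ' ⟶ Δ} (h₀ : t₀ = t₀') (h : ∀ j, t j = t' j)
    (hη : η = η') : dayMap t₀ α hα t η = dayMap t₀' α hα' t' η' := by
  obtain rfl : t = t' := funext h
  rw [h₀, hη]

theorem dayMap_id {k : ℕ} (X₀ : (Ctx S C n)ᵒᵖ ⥤ Type u) (X : Fin k → (Ctx S C n)ᵒᵖ ⥤ Type u)
    (Δ : Ctx S C n) :
    dayMap (𝟙 X₀) (fun i => i) .id (fun i => 𝟙 (X i)) (𝟙 Δ) = 𝟙 (day X₀ X Δ) := by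
  refine day_hom_ext fun Γ z => ?_
  rw [dayMap_ι]
  have e : z.act (𝟙 X₀) (fun i => i) .id (fun i => 𝟙 (X i)) (𝟙 Δ) = z := by
    refine DayElt.ext' rfl (fun _ => rfl) ?_
    change 𝟙 Δ ≫ z.mor ≫ Ctx.tensMap (𝟙 Γ.1) (fun i => i) .id (fun j => 𝟙 (Γ.2 j)) = z.mor
    rw [Ctx.tensMap_id, Category.id_comp, Category.comp_id]
  rw [e]
  rfl

theorem dayMap_comp {k l m : ℕ} {X₀ Y₀ Z₀ : (Ctx S C n)ᵒᵖ ⥤ Type u}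
    {X : Fin k → (Ctx S C n)ᵒᵖ ⥤ Type u} {Y : Fin l → (Ctx S C n)ᵒᵖ ⥤ Type u}
    {Z : Fin m → (Ctx S C n)ᵒᵖ ⥤ Type u} {Δ Δ' Δ'' : Ctx S C n}
    (t₀ : X₀ ⟶ Y₀) (α : Fin l → Fin k) (hα : S.Adm α) (t : ∀ j, X (α j) ⟶ Y j) (η : Δ' ⟶ Δ)
    (s₀ : Y₀ ⟶ Z₀) (β : Fin m → Fin l) (hβ : S.Adm β) (s : ∀ j, Y (β j) ⟶ Z j) (θ : Δ'' ⟶ Δ') :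
    dayMap t₀ α hα t η ≫ dayMap s₀ β hβ s θ =
      dayMap (t₀ ≫ s₀) (fun j => α (β j)) (hα.comp hβ) (fun j => t (β j) ≫ s j) (θ ≫ η) := by
  refine day_hom_ext fun Γ z => ?_
  change dayMap s₀ β hβ s θ (dayMap t₀ α hα t η (coend.ι (dayIntegrand X₀ X Δ) Γ z)) = _
  rw [dayMap_ι, dayMap_ι, dayMap_ι]
  refine congrArg (coend.ι (dayIntegrand Z₀ Z Δ'') (Γ.1, fun j => Γ.2 (α (β j)))) ?_
  refine DayElt.ext' rfl (fun _ => rfl) ?_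
  change θ ≫ (η ≫ z.mor ≫ Ctx.tensMap (𝟙 Γ.1) α hα (fun j => 𝟙 (Γ.2 (α j)))) ≫
      Ctx.tensMap (𝟙 Γ.1) β hβ (fun j => 𝟙 (Γ.2 (α (β j)))) =
    (θ ≫ η) ≫ z.mor ≫ Ctx.tensMap (𝟙 Γ.1) (fun j => α (β j)) (hα.comp hβ)
      (fun j => 𝟙 (Γ.2 (α (β j))))
  simp only [Category.assoc, Ctx.tensMap_comp, Category.comp_id]

end Day

/-! ### The denotation of λ-terms -/

section Denotation

variable {S : ResourceMonad} {A : Type u} [SmallCategory A] {n : ℕ}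

/-- `⟦xᵢ⟧(Δ, a) = S Dⁿ(Δ, ⟨⟨⟩, …, ⟨a⟩, …, ⟨⟩⟩)`. -/
def denVar (i : Fin n) : Profunctor.{u} (Ty S A) (Ctx S (Ty S A) n) :=
  .ofCore
    { obj := fun a Δ => Δ ⟶ (Ctx.single i).obj a
      map := fun g η => ↾fun z => η ≫ z ≫ (Ctx.single i).map g
      map_id := fun a Δ => by
        refine ConcreteCategory.hom_ext _ _ fun z => ?_
        change 𝟙 Δ ≫ z ≫ (Ctx.single i).map (𝟙 a) = z
        simp
      map_comp := fun g g' η η' => by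
        refine ConcreteCategory.hom_ext _ _ fun z => ?_
        change (η ≫ η') ≫ z ≫ (Ctx.single i).map (g ≫ g') =
          η ≫ (η' ≫ z ≫ (Ctx.single i).map g) ≫ (Ctx.single i).map g'
        simp }

/-- `⟦λ x. M⟧(Δ, as ⇒ a) = ⟦M⟧(Δ ⊕ as, a)`, and `⟦λ x. M⟧(Δ, o) = ∅` for an atom `o`. -/
def denLamObj (F : Profunctor.{u} (Ty S A) (Ctx S (Ty S A) (n + 1))) :
    Ty S A → Ctx S (Ty S A) n → Type u
  | .atom _, _ => PEmpty
  | .arr k as a, Δ => (F.obj a).obj (op (Ctx.cons.obj (⟨k, as⟩, Δ)))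

/-- The action of `denLamObj` on morphisms: `⟨α, f₁, …, fₖ⟩ ⇒ g` acts on `⟦M⟧` covariantly by `g`
and contravariantly by `⟨α, f₁, …, fₖ⟩`. -/
def denLamMap (F : Profunctor.{u} (Ty S A) (Ctx S (Ty S A) (n + 1))) {Δ' Δ : Ctx S (Ty S A) n}
    (η : Δ' ⟶ Δ) : {a b : Ty S A} → Ty.Hom a b → (denLamObj F a Δ ⟶ denLamObj F b Δ')
  | _, _, .atom _ => 𝟙 _
  | .arr k as _, .arr l bs _, .arr α hα f g =>
      (F.map g).app _ ≫ (F.obj _).map (Ctx.cons.map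
        (X := (ResList.mk l bs, Δ')) (Y := (ResList.mk k as, Δ)) (Fam.Hom.mk α hα f, η)).op

/-- `⟦λ x. M⟧` as a functor of `⟦M⟧`. -/
def denLam (F : Profunctor.{u} (Ty S A) (Ctx S (Ty S A) (n + 1))) :
    Profunctor.{u} (Ty S A) (Ctx S (Ty S A) n) :=
  .ofCore
    { obj := denLamObj F
      map := fun g η => denLamMap F η g
      map_id := fun a Δ => by
        cases a with
        | atom o => rfl
        | arr k as a =>
          change (F.map (𝟙 a)).app _ ≫ (F.obj a).map (Ctx.cons.map (𝟙 (ResList.mk k as, Δ))).op = 𝟙 _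
          rw [F.map_id, NatTrans.id_app, Category.id_comp, Ctx.cons.map_id, op_id,
            CategoryTheory.Functor.map_id]
      map_comp := fun {a b c Δ Δ' Δ''} g g' η η' => by
        change Ty.Hom a b at g
        change Ty.Hom b c at g'
        cases g with
        | atom f =>
          cases g'
          rfl
        | @arr k l as bs a b α hα f g =>
          cases g' with
          | @arr _ m _ cs _ c β hβ f' g' =>
          change (F.map (g ≫ g')).app _ ≫ (F.obj c).map (Ctx.cons.map
              (X := (ResList.mk m cs, Δ)) (Y := (ResList.mk k as, Δ''))
              (CategoryStruct.comp (X := (ResList.mk m cs, Δ)) (Y := (ResList.mk l bs, Δ'))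
                (Z := (ResList.mk k as, Δ'')) (Fam.Hom.mk β hβ f', η) (Fam.Hom.mk α hα f, η'))).op =
            ((F.map g).app _ ≫ (F.obj b).map (Ctx.cons.map
              (X := (ResList.mk l bs, Δ')) (Y := (ResList.mk k as, Δ''))
              (Fam.Hom.mk α hα f, η')).op) ≫
            (F.map g').app _ ≫ (F.obj c).map (Ctx.cons.map
              (X := (ResList.mk m cs, Δ)) (Y := (ResList.mk l bs, Δ'))
              (Fam.Hom.mk β hβ f', η)).op
          simp only [Functor.map_comp, op_comp, NatTrans.comp_app, Category.assoc,
            NatTrans.naturality_assoc] }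

/-- The functor `(as, bs) ↦ (F(-, as ⇒ a) ⊗̂ G(-, b₁) ⊗̂ … ⊗̂ G(-, bₖ))(Δ)`, where
`bs = ⟨b₁, …, bₖ⟩`. -/
noncomputable def appIntegrand (F G : Profunctor.{u} (Ty S A) (Ctx S (Ty S A) n)) (a : Ty S A)
    (Δ : Ctx S (Ty S A) n) :
    (ResList S (Ty S A))ᵒᵖ ⥤ ResList S (Ty S A) ⥤ Type u where
  obj as :=
    { obj := fun bs => day (F.obj (Ty.arrow.obj (as, a))) (fun i => G.obj (bs.get i)) Δ
      map := fun f => dayMap (𝟙 _) f.fn f.adm (fun j => G.map (f.f j)) (𝟙 Δ)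
      map_id := fun bs => (dayMap_congr rfl (fun i => G.map_id (bs.get i)) rfl).trans
        (dayMap_id _ _ _)
      map_comp := fun f g => by
        rw [dayMap_comp]
        exact dayMap_congr (Category.comp_id _).symm (fun j => G.map_comp _ _)
          (Category.comp_id _).symm }
  map h :=
    { app := fun bs => dayMap (F.map (Ty.arrow.map (h, 𝟙 a))) (fun i => i) .id (fun _ => 𝟙 _) (𝟙 Δ)
      naturality := fun bs cs f => by
        rw [dayMap_comp, dayMap_comp]
        exact dayMap_congr ((Category.id_comp _).trans (Category.comp_id _).symm)
          (fun j => (Category.comp_id _).trans (Category.id_comp _).symm) rfl }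
  map_id as := by
    refine NatTrans.ext (funext fun bs => ?_)
    refine (dayMap_congr ?_ (fun _ => rfl) rfl).trans (dayMap_id _ _ _)
    exact (congrArg F.map (Ty.arrow.map_id (as, a))).trans (F.map_id _)
  map_comp h h' := by
    refine NatTrans.ext (funext fun bs => ?_)
    rw [NatTrans.comp_app, dayMap_comp]
    refine dayMap_congr ?_ (fun _ => (Category.comp_id _).symm) (Category.comp_id _).symm
    rw [← F.map_comp, ← Ty.arrow.map_comp, prod_comp, Category.comp_id]

/-- The action of `g : a ⟶ b` and `η : Δ' ⟶ Δ` on the integrands. -/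
noncomputable def appIntegrandMap (F G : Profunctor.{u} (Ty S A) (Ctx S (Ty S A) n))
    {a b : Ty S A} {Δ' Δ : Ctx S (Ty S A) n} (g : a ⟶ b) (η : Δ' ⟶ Δ) :
    appIntegrand F G a Δ ⟶ appIntegrand F G b Δ' where
  app as :=
    { app := fun bs => dayMap (F.map (Ty.arrow.map (X := (as, a)) (Y := (as, b)) (𝟙 as, g)))
        (fun i => i) .id (fun i => 𝟙 (G.obj (bs.get i))) η
      naturality := fun bs cs f => by
        refine (dayMap_comp _ _ _ _ _ _ _ _ _ _).trans (Eq.trans ?_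
          (dayMap_comp _ _ _ _ _ _ _ _ _ _).symm)
        exact dayMap_congr ((Category.id_comp _).trans (Category.comp_id _).symm)
          (fun j => (Category.comp_id _).trans (Category.id_comp _).symm)
          ((Category.comp_id _).trans (Category.id_comp _).symm) }
  naturality as as' h := by
    refine NatTrans.ext (funext fun bs => ?_)
    refine (dayMap_comp _ _ _ _ _ _ _ _ _ _).trans (Eq.trans ?_
      (dayMap_comp _ _ _ _ _ _ _ _ _ _).symm)
    refine dayMap_congr ?_ (fun _ => rfl) ((Category.comp_id _).trans (Category.id_comp _).symm)
    rw [← F.map_comp, ← F.map_comp, ← Ty.arrow.map_comp, ← Ty.arrow.map_comp, prod_comp, prod_comp,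
      Category.comp_id, Category.id_comp, Category.comp_id, Category.id_comp]

/-- `⟦M N⟧(Δ, a) = ∫^{as = ⟨a₁, …, aₖ⟩ ∈ S D} ∫^{Γ₀, …, Γₖ ∈ S Dⁿ}
⟦M⟧(Γ₀, as ⇒ a) × ∏ᵢ ⟦N⟧(Γᵢ, aᵢ) × S Dⁿ(Δ, Γ₀ ⊗ Γ₁ ⊗ … ⊗ Γₖ)`. -/
noncomputable def denApp (F G : Profunctor.{u} (Ty S A) (Ctx S (Ty S A) n)) :
    Profunctor.{u} (Ty S A) (Ctx S (Ty S A) n) :=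
  .ofCore
    { obj := fun a Δ => coend (appIntegrand F G a Δ)
      map := fun g η => coend.map (appIntegrandMap F G g η)
      map_id := fun a Δ => by
        have e : appIntegrandMap F G (𝟙 a) (𝟙 Δ) = 𝟙 _ := by
          refine NatTrans.ext (funext fun as => NatTrans.ext (funext fun bs => ?_))
          refine (dayMap_congr ?_ (fun _ => rfl) rfl).trans (dayMap_id _ _ _)
          exact (congrArg F.map (Ty.arrow.map_id (as, a))).trans (F.map_id _)
        rw [e, coend.map_id]
      map_comp := fun g g' η η' => by
        have e : appIntegrandMap F G (g ≫ g') (η ≫ η') =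
            appIntegrandMap F G g η' ≫ appIntegrandMap F G g' η := by
          refine NatTrans.ext (funext fun as => NatTrans.ext (funext fun bs => ?_))
          refine Eq.trans ?_ (dayMap_comp _ _ _ _ _ _ _ _ _ _).symm
          refine dayMap_congr ?_ (fun _ => (Category.comp_id _).symm) rfl
          rw [← F.map_comp, ← Ty.arrow.map_comp, prod_comp, Category.comp_id]
        rw [e, coend.map_comp] }

variable (S A) in
/-- The denotation `⟦M⟧ : D ⇸ S Dⁿ` of a λ-term `M` with free variables among `x₁, …, xₙ`. -/
noncomputable def den : {n : ℕ} → Term n → Profunctor.{u} (Ty S A) (Ctx S (Ty S A) n)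
  | _, .var i => denVar i
  | _, .lam M => denLam (den M)
  | _, .app M N => denApp (den M) (den N)

/-- `F : B ⇸ C` is the zero distributor: all its values are empty. -/
def IsZeroDistributor {B C : Type u} [SmallCategory B] [SmallCategory C]
    (F : Profunctor.{u} B C) : Prop :=
  ∀ (c : C) (b : B), IsEmpty ((F.obj b).obj (op c))

end Denotation

end ITD

namespace ITD

namespace Term

/-! ### Head-normal forms and head-reduction -/

/-! Only emptiness of the values matters, and a coend of sets is inhabited exactly when some
diagonal value of its integrand is (`nonempty_coend_iff`). The coends therefore collapse to
existential quantifiers and the hom-sets of contexts to a preorder `Le`. What remains is an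
intersection type system `Typed`, and `nonempty_den_iff` identifies its derivable judgements with
the inhabited values. Its contexts are flat: all declarations form one finite family labelled by
variables, so that the structural isomorphisms of the tensor become bijections of index sets.

Typable terms have terminating head-reduction by Tait's reducibility method. An atom is interpreted
by the terms whose head-reduction ends, a list of types by the intersection of the interpretations,
an arrow by the function space. Morphisms of types become inclusions (`Reducible.map`), and
multiplicity and order of declarations are forgotten, so one argument serves the four monads.
Reducible sets are closed under head-expansion (`Reducible.of_inst`), contain the neutral terms, and
consist of terms with terminating head-reduction (`reducible_of_neutral_and_ends`). Soundness is
`Typed.reducible_subst`.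

A step of `headReduct` is trivial or a β-step, so termination gives a head-normal form.

Conversely, a head-normal form is typable: its head variable can be given a type whose argument
lists are all empty, so the arguments need no typing. Typability goes back along β by subject
expansion (`Typed.of_beta`). Its core is `Typed.exists_of_subst`: a typing of a substituted term
splits into a typing of the original term and one derivation for each declaration used there. -/

/-- The terms `x N₁ ⋯ Nₖ`. -/
def Neutral : {n : ℕ} → Term n → Prop
  | _, var _ => True
  | _, lam _ => False
  | _, app M _ => Neutral M

/-- A recursive description of head-normal forms; see `isHeadNormal_iff`. -/
def HeadNormal : {n : ℕ} → Term n → Prop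
  | _, var _ => True
  | _, lam M => HeadNormal M
  | _, app M _ => Neutral M

theorem apps_concat {n : ℕ} (M : Term n) (Ns : List (Term n)) (N : Term n) :
    apps M (Ns ++ [N]) = app (apps M Ns) N := by
  simp [apps]

theorem neutral_apps_var {n : ℕ} (x : Fin n) (Ns : List (Term n)) : Neutral (apps (var x) Ns) := by
  induction Ns using List.reverseRecOn with
  | nil => trivial
  | append_singleton Ns N ih => rwa [apps_concat]

theorem Neutral.exists_apps {n : ℕ} {M : Term n} (h : Neutral M) :
    ∃ x Ns, M = apps (var x) Ns := by
  induction M with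
  | var i => exact ⟨i, [], rfl⟩
  | lam M => exact h.elim
  | app M N ih =>
    obtain ⟨x, Ns, rfl⟩ := ih h
    exact ⟨x, Ns ++ [N], (apps_concat _ _ _).symm⟩

theorem Neutral.headNormal {n : ℕ} {M : Term n} (h : Neutral M) : HeadNormal M := by
  cases M with
  | var i => trivial
  | lam M => exact h.elim
  | app M N => exact h

theorem headNormal_lams {n : ℕ} (m : ℕ) (M : Term (n + m)) :
    HeadNormal (lams m M) ↔ HeadNormal M := by
  induction m with
  | zero => rfl
  | succ m ih => exact ih (lam M)

theorem lam_cast {n m : ℕ} (h : n = m) (h' : n + 1 = m + 1) (M : Term (n + 1)) :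
    lam (h' ▸ M) = h ▸ lam M := by
  subst h
  rfl

/-- `lams` unfolds from the inside, while induction on a term adds abstractions on the outside; the
two scopes agree only up to an equality of natural numbers. -/
theorem lam_lams {n : ℕ} (m : ℕ) (h : n + 1 + m = n + (m + 1)) (M : Term (n + 1 + m)) :
    lam (lams m M) = lams (m + 1) (h ▸ M) := by
  induction m with
  | zero => rfl
  | succ m ih =>
    have h' : n + 1 + m = n + (m + 1) := by omega
    calc lam (lams (m + 1) M) = lam (lams m (lam M)) := rfl
      _ = lams (m + 1) (h' ▸ lam M) := ih h' (lam M)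
      _ = lams (m + 1) (lam (h ▸ M)) := congrArg _ (lam_cast h' h M).symm

theorem neutral_cast {n m : ℕ} (h : n = m) {M : Term n} (hM : Neutral M) :
    Neutral (h ▸ M : Term m) := by
  subst h
  exact hM

theorem isHeadNormal_iff {n : ℕ} (M : Term n) : IsHeadNormal M ↔ HeadNormal M := by
  have aux : HeadNormal M → ∃ m, ∃ N : Term (n + m), Neutral N ∧ M = lams m N := by
    intro h
    induction M with
    | var i => exact ⟨0, var i, trivial, rfl⟩
    | app M N => exact ⟨0, app M N, h, rfl⟩
    | @lam n M ih =>
      obtain ⟨m, N, hN, rfl⟩ := ih h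
      have e : n + 1 + m = n + (m + 1) := by omega
      exact ⟨m + 1, e ▸ N, neutral_cast e hN, lam_lams m e N⟩
  constructor
  · rintro ⟨m, x, Ns, rfl⟩
    exact (headNormal_lams _ _).2 (neutral_apps_var x Ns).headNormal
  · intro h
    obtain ⟨m, N, hN, rfl⟩ := aux h
    obtain ⟨x, Ns, rfl⟩ := hN.exists_apps
    exact ⟨m, x, Ns, rfl⟩

theorem headReductionEnds_headReduct_iff {n : ℕ} (M : Term n) :
    HeadReductionEnds (headReduct M) ↔ HeadReductionEnds M := by
  constructor
  · rintro ⟨k, h⟩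
    exact ⟨k + 1, h⟩
  · rintro ⟨k | k, h⟩
    -- A head-normal form is a fixed point of `headReduct`, so zero steps still suffice.
    · exact ⟨0, by rwa [headReduct_headNormal (M := M) h]⟩
    · exact ⟨k, h⟩

theorem HeadReductionEnds.of_headNormal {n : ℕ} {M : Term n} (h : HeadNormal M) :
    HeadReductionEnds M :=
  ⟨0, (isHeadNormal_iff _).2 h⟩

theorem headReductionEnds_lam_iff {n : ℕ} (M : Term (n + 1)) :
    HeadReductionEnds (lam M) ↔ HeadReductionEnds M := by
  have h : ∀ k, headReduct^[k] (lam M) = lam (headReduct^[k] M) := by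
    intro k
    induction k with
    | zero => rfl
    | succ k ih => rw [Function.iterate_succ_apply', ih, headReduct, Function.iterate_succ_apply']
  simp only [HeadReductionEnds, h, isHeadNormal_iff, HeadNormal]

/-! ### Renaming and substitution -/

theorem rename_rename {n m l : ℕ} (ρ : Fin n → Fin m) (ρ' : Fin m → Fin l) (M : Term n) :
    rename ρ' (rename ρ M) = rename (ρ' ∘ ρ) M := by
  induction M generalizing m l with
  | var i => rfl
  | app M N ihM ihN => simp only [rename, ihM, ihN]
  | lam M ih =>
    simp only [rename, ih]
    congr 2
    funext i
    cases i using Fin.cases <;> rfl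

theorem subst_rename {n m l : ℕ} (ρ : Fin n → Fin m) (σ : Fin m → Term l) (M : Term n) :
    subst σ (rename ρ M) = subst (σ ∘ ρ) M := by
  induction M generalizing m l with
  | var i => rfl
  | app M N ihM ihN => simp only [rename, subst, ihM, ihN]
  | lam M ih =>
    simp only [rename, subst, ih]
    congr 2
    funext i
    cases i using Fin.cases <;> rfl

theorem rename_subst {n m l : ℕ} (σ : Fin n → Term m) (ρ : Fin m → Fin l) (M : Term n) :
    rename ρ (subst σ M) = subst (fun i => rename ρ (σ i)) M := by
  induction M generalizing m l with
  | var i => rfl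
  | app M N ihM ihN => simp only [rename, subst, ihM, ihN]
  | lam M ih =>
    simp only [rename, subst, ih]
    congr 2
    funext i
    cases i using Fin.cases with
    | zero => rfl
    | succ i => simp only [Fin.cases_succ, rename_rename]; rfl

theorem subst_subst {n m l : ℕ} (σ : Fin n → Term m) (τ : Fin m → Term l) (M : Term n) :
    subst τ (subst σ M) = subst (fun i => subst τ (σ i)) M := by
  induction M generalizing m l with
  | var i => rfl
  | app M N ihM ihN => simp only [subst, ihM, ihN]
  | lam M ih =>
    simp only [subst, ih]
    congr 2
    funext i
    cases i using Fin.cases with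
    | zero => rfl
    | succ i => simp only [Fin.cases_succ, subst_rename, rename_subst]; rfl

theorem subst_var_comp {n m : ℕ} (ρ : Fin n → Fin m) (M : Term n) :
    subst (fun i => var (ρ i)) M = rename ρ M := by
  induction M generalizing m with
  | var i => rfl
  | app M N ihM ihN => simp only [rename, subst, ihM, ihN]
  | lam M ih =>
    simp only [rename, subst, ← ih]
    congr 2
    funext i
    cases i using Fin.cases <;> rfl

theorem rename_id {n : ℕ} (M : Term n) : rename (fun i => i) M = M := by
  induction M with
  | var i => rfl
  | app M N ihM ihN => simp only [rename, ihM, ihN]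
  | lam M ih =>
    simp only [rename]
    congr 1
    conv_rhs => rw [← ih]
    congr 1
    funext i
    cases i using Fin.cases <;> rfl

/-- Fuses the β-step with the substitution lifted under the binder; this is what the abstraction
case of `Typed.reducible_subst` needs. -/
theorem inst_lift {n m : ℕ} (σ : Fin n → Term m) (M : Term (n + 1)) (N : Term m) :
    inst (subst (Fin.cases (var 0) fun i => rename Fin.succ (σ i)) M) N =
      subst (Fin.cases N σ) M := by
  rw [inst, subst_subst]
  congr 1
  funext i
  cases i using Fin.cases with
  | zero => rfl
  | succ i =>
    simp only [Fin.cases_succ, subst_rename]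
    exact (subst_var_comp (fun i => i) _).trans (rename_id _)

theorem inst_var {n : ℕ} (M : Term (n + 1)) (x : Fin n) :
    inst M (var x) = rename (Fin.cases x fun i => i) M := by
  rw [inst, ← subst_var_comp]
  congr 1
  funext i
  cases i using Fin.cases <;> rfl

theorem rename_inst {n m : ℕ} (ρ : Fin n → Fin m) (M : Term (n + 1)) (N : Term n) :
    rename ρ (inst M N) = inst (rename (Fin.cases 0 fun i => (ρ i).succ) M) (rename ρ N) := by
  rw [inst, inst, rename_subst, subst_rename]
  congr 1
  funext i
  cases i using Fin.cases <;> rfl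

/-! ### Head-reduction under renaming and under application to a variable. -/

theorem headReduct_rename {n m : ℕ} (ρ : Fin n → Fin m) (M : Term n) :
    headReduct (rename ρ M) = rename ρ (headReduct M) := by
  induction M generalizing m with
  | var i => rfl
  | lam M ih => simp only [rename, headReduct, ih]
  | app M N ih _ =>
    cases M with
    | var i => rfl
    | lam M => simp only [rename, headReduct, rename_inst]
    | app P Q => simpa only [rename, headReduct, app.injEq, and_true] using ih ρ

theorem neutral_rename {n m : ℕ} (ρ : Fin n → Fin m) (M : Term n) :
    Neutral (rename ρ M) ↔ Neutral M := by
  induction M generalizing m with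
  | var i => rfl
  | lam M ih => rfl
  | app M N ih _ => exact ih ρ

theorem headNormal_rename {n m : ℕ} (ρ : Fin n → Fin m) (M : Term n) :
    HeadNormal (rename ρ M) ↔ HeadNormal M := by
  induction M generalizing m with
  | var i => rfl
  | lam M ih => exact ih _
  | app M N => exact neutral_rename ρ M

theorem headReductionEnds_rename {n m : ℕ} (ρ : Fin n → Fin m) (M : Term n) :
    HeadReductionEnds (rename ρ M) ↔ HeadReductionEnds M := by
  have h : ∀ k, headReduct^[k] (rename ρ M) = rename ρ (headReduct^[k] M) := by
    intro k
    induction k with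
    | zero => rfl
    | succ k ih =>
      rw [Function.iterate_succ_apply', ih, headReduct_rename, Function.iterate_succ_apply']
  simp only [HeadReductionEnds, h, isHeadNormal_iff, headNormal_rename]

/-- The reduction of `M x` follows that of `M` until an abstraction is met. Contracting it against a
variable is only a renaming, which preserves and reflects termination even when it is not injective;
hence `x` need not be fresh. -/
theorem HeadReductionEnds.of_app_var {n : ℕ} {M : Term n} {x : Fin n}
    (h : HeadReductionEnds (app M (var x))) : HeadReductionEnds M := by
  obtain ⟨k, h⟩ := h
  induction k generalizing M with
  | zero => exact .of_headNormal ((isHeadNormal_iff _).1 h : Neutral M).headNormal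
  | succ k ih =>
    cases M with
    | var i => exact .of_headNormal trivial
    | lam P =>
      -- The first head step contracts this redex, so the remaining `k` steps are those of the
      -- contractum.
      have h' : HeadReductionEnds (inst P (var x)) := ⟨k, h⟩
      rwa [inst_var, headReductionEnds_rename, ← headReductionEnds_lam_iff] at h'
    | app P Q => exact (headReductionEnds_headReduct_iff _).1 (ih h)

theorem beta_headReduct {n : ℕ} (M : Term n) : headReduct M = M ∨ Beta M (headReduct M) := by
  induction M with
  | var i => exact .inl rfl
  | lam M ih => exact ih.imp (congrArg lam) Beta.lam
  | app M N ih _ =>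
    cases M with
    | var i => exact .inl rfl
    | lam P => exact .inr (.beta P N)
    | app P Q => exact ih.imp (congrArg (app · N)) (Beta.appLeft N)

theorem HeadReductionEnds.headNormalizable {n : ℕ} {M : Term n} (h : HeadReductionEnds M) :
    HeadNormalizable M := by
  obtain ⟨k, h⟩ := h
  refine ⟨_, ?_, h⟩
  clear h
  induction k with
  | zero => exact .refl
  | succ k ih =>
    rw [Function.iterate_succ_apply']
    rcases beta_headReduct (headReduct^[k] M) with e | e
    · rwa [e]
    · exact ih.tail e

end Term
-- Restriction of admissible functions to summands.
theorem ResourceMonad.adm_sumMap_iff {S : ResourceMonad} {X Y X' Y' : Type} {α : X → Y}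
    {β : X' → Y'} : S.Adm (Sum.map α β) ↔ S.Adm α ∧ S.Adm β := by
  cases S
  exacts [Sum.map_bijective, Sum.map_injective, Sum.map_surjective, (and_self_iff).symm]

theorem ResourceMonad.Adm.of_sigmaMap {S : ResourceMonad} {I : Type} {X Y : I → Type}
    {β : ∀ i, X i → Y i} (h : S.Adm (Sigma.map _root_.id β)) (i : I) : S.Adm (β i) := by
  have inj : Function.Injective (Sigma.map _root_.id β) → Function.Injective (β i) :=
    fun h => h.of_sigma_map i
  have surj : Function.Surjective (Sigma.map _root_.id β) → Function.Surjective (β i) := by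
    intro h y
    obtain ⟨⟨j, x⟩, e⟩ := h ⟨i, y⟩
    obtain rfl : j = i := congrArg Sigma.fst e
    exact ⟨x, eq_of_heq (Sigma.mk.inj e).2⟩
  cases S
  exacts [⟨inj h.1, surj h.2⟩, inj h, surj h, trivial]

/-! ### Flat contexts -/

/-- A finite family of declarations `x : a`, with `x` among `n` variables: a type context whose
lists have been merged into a single family. -/
structure FlatCtx (S : ResourceMonad) (A : Type u) (n : ℕ) where
  idx : Type
  [finite : Finite idx]
  var : idx → Fin n
  ty : idx → Ty S A

attribute [instance] FlatCtx.finite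

namespace FlatCtx

variable {S : ResourceMonad} {A : Type u} {n m : ℕ}

/-- The context with the only declaration `x : a`. -/
def single (x : Fin n) (a : Ty S A) : FlatCtx S A n where
  idx := Unit
  var _ := x
  ty _ := a

/-- The extension of `Γ` by declarations of the variable `0`. -/
def cons {k : ℕ} (as : Fin k → Ty S A) (Γ : FlatCtx S A n) : FlatCtx S A (n + 1) where
  idx := Fin k ⊕ Γ.idx
  var := Sum.elim (fun _ => 0) fun i => (Γ.var i).succ
  ty := Sum.elim as Γ.ty

/-- The tensor product of a finite family of contexts. -/
def bigTens {I : Type} [Finite I] (Γ : I → FlatCtx S A n) : FlatCtx S A n where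
  idx := Σ i, (Γ i).idx
  var x := (Γ x.1).var x.2
  ty x := (Γ x.1).ty x.2

/-- The tensor product of two contexts. -/
def tens (Γ Δ : FlatCtx S A n) : FlatCtx S A n where
  idx := Γ.idx ⊕ Δ.idx
  var := Sum.elim Γ.var Δ.var
  ty := Sum.elim Γ.ty Δ.ty

/-- The weakening of a context by a new variable `0`. -/
def shift (Γ : FlatCtx S A n) : FlatCtx S A (n + 1) where
  idx := Γ.idx
  var i := (Γ.var i).succ
  ty := Γ.ty

/-- The declarations of the variable `0` in a context can be put first. -/
theorem exists_cons_equiv (Γ : FlatCtx S A (n + 1)) :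
    ∃ (k : ℕ) (as : Fin k → Ty S A) (Γ' : FlatCtx S A n) (e : (cons as Γ').idx ≃ Γ.idx),
      (∀ i, Γ.var (e i) = (cons as Γ').var i) ∧ ∀ i, Γ.ty (e i) = (cons as Γ').ty i := by
  classical
  obtain ⟨k, ⟨e⟩⟩ := Finite.exists_equiv_fin {i : Γ.idx // Γ.var i = 0}
  refine ⟨k, fun j => Γ.ty (e.symm j), ⟨{i : Γ.idx // Γ.var i ≠ 0}, fun j => (Γ.var j).pred j.2,
    fun j => Γ.ty j⟩, (Equiv.sumCongr e.symm (Equiv.refl _)).trans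
      (Equiv.sumCompl fun i => Γ.var i = 0), ?_, ?_⟩
  · rintro (i | i)
    exacts [(e.symm i).2, (Fin.succ_pred _ i.2).symm]
  · rintro (i | i) <;> rfl

variable [SmallCategory A]

/-- There is a morphism of contexts from `Γ` to `Δ`. -/
def Le (Γ Δ : FlatCtx S A n) : Prop :=
  ∃ α : Δ.idx → Γ.idx, S.Adm α ∧
    ∀ i, Γ.var (α i) = Δ.var i ∧ Nonempty (Γ.ty (α i) ⟶ Δ.ty i)

theorem Le.refl (Γ : FlatCtx S A n) : Le Γ Γ :=
  ⟨fun i => i, .id, fun _ => ⟨rfl, ⟨𝟙 _⟩⟩⟩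

theorem Le.trans {Γ Δ Θ : FlatCtx S A n} (h : Le Γ Δ) (h' : Le Δ Θ) : Le Γ Θ := by
  obtain ⟨α, hα, p⟩ := h
  obtain ⟨β, hβ, q⟩ := h'
  refine ⟨fun i => α (β i), hα.comp hβ, fun i => ⟨(p _).1.trans (q i).1, ?_⟩⟩
  obtain ⟨f⟩ := (p (β i)).2
  obtain ⟨g⟩ := (q i).2
  exact ⟨f ≫ g⟩

/-- Bijections are admissible for all four monads. The associativity, symmetry and unit isomorphisms
of the tensor enter the type system through this lemma. -/
theorem Le.of_equiv {Γ Δ : FlatCtx S A n} (e : Δ.idx ≃ Γ.idx) (h : ∀ i, Γ.var (e i) = Δ.var i)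
    (h' : ∀ i, Γ.ty (e i) = Δ.ty i) : Le Γ Δ :=
  ⟨e, .of_bijective e.bijective, fun i => ⟨h i, ⟨eqToHom (h' i)⟩⟩⟩

theorem Le.tens {Γ Γ' Δ Δ' : FlatCtx S A n} (h : Le Γ Γ') (h' : Le Δ Δ') :
    Le (tens Γ Δ) (tens Γ' Δ') := by
  obtain ⟨α, hα, p⟩ := h
  obtain ⟨β, hβ, q⟩ := h'
  refine ⟨Sum.map α β, hα.sumMap hβ, ?_⟩
  rintro (i | i)
  exacts [p i, q i]

theorem Le.bigTens {I : Type} [Finite I] {Γ Γ' : I → FlatCtx S A n} (h : ∀ i, Le (Γ i) (Γ' i)) :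
    Le (bigTens Γ) (bigTens Γ') := by
  choose α hα p using h
  exact ⟨Sigma.map (fun i => i) α, .sigmaMap .id hα, fun x => p x.1 x.2⟩

theorem Le.cons {k : ℕ} (as : Fin k → Ty S A) {Γ Γ' : FlatCtx S A n} (h : Le Γ Γ') :
    Le (cons as Γ) (cons as Γ') := by
  obtain ⟨α, hα, p⟩ := h
  refine ⟨Sum.map (fun i => i) α, .sumMap .id hα, ?_⟩
  rintro (i | i)
  exacts [⟨rfl, ⟨𝟙 _⟩⟩, ⟨congrArg Fin.succ (p i).1, (p i).2⟩]

/-- The index function respects variables, so it cannot mix declarations of the variable `0` with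
the others: it is a sum of two functions, and each summand is admissible. The block over `0` can
then be reused beside any context `Θ`, as `Derives.of_lift` requires. -/
theorem Le.of_cons {k l : ℕ} {as : Fin k → Ty S A} {bs : Fin l → Ty S A} {Γ Δ : FlatCtx S A n}
    (h : Le (FlatCtx.cons as Γ) (FlatCtx.cons bs Δ)) :
    Le Γ Δ ∧ ∀ {m : ℕ} (Θ : FlatCtx S A m), Le (FlatCtx.cons as Θ) (FlatCtx.cons bs Θ) := by
  obtain ⟨α, hα, p⟩ := h
  have h₁ : ∀ j : Fin l, ∃ i : Fin k, α (.inl j) = .inl i := by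
    intro j
    have h := (p (.inl j)).1
    rcases e : α (.inl j) with i | i
    · exact ⟨i, rfl⟩
    · rw [e] at h
      exact (Fin.succ_ne_zero _ h).elim
  have h₂ : ∀ j : Δ.idx, ∃ i : Γ.idx, α (.inr j) = .inr i := by
    intro j
    have h := (p (.inr j)).1
    rcases e : α (.inr j) with i | i
    · rw [e] at h
      exact (Fin.succ_ne_zero _ h.symm).elim
    · exact ⟨i, rfl⟩
  choose β hβ using h₁
  choose γ hγ using h₂
  obtain rfl : α = Sum.map β γ := by
    funext i
    rcases i with i | i
    exacts [hβ i, hγ i]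
  replace hα := ResourceMonad.adm_sumMap_iff.1 hα
  refine ⟨⟨γ, hα.2, fun i => ⟨Fin.succ_injective _ (p (.inr i)).1, (p (.inr i)).2⟩⟩,
    fun _ => ⟨Sum.map β fun i => i, hα.1.sumMap .id, ?_⟩⟩
  rintro (i | i)
  exacts [⟨rfl, (p (.inl i)).2⟩, ⟨rfl, ⟨𝟙 _⟩⟩]

theorem Le.cons_of_shift {k : ℕ} (as : Fin k → Ty S A) (Γ : FlatCtx S A n) :
    Le (FlatCtx.tens (shift Γ) (FlatCtx.bigTens fun j => single 0 (as j)))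
      (FlatCtx.cons as Γ) := by
  refine .of_equiv ((Equiv.sumComm _ _).trans
    (Equiv.sumCongr (Equiv.refl _) (Equiv.sigmaPUnit (Fin k)).symm)) ?_ ?_
  all_goals
    rintro (i | i) <;> rfl

theorem exists_cons (Γ : FlatCtx S A (n + 1)) :
    ∃ (k : ℕ) (as : Fin k → Ty S A) (Γ' : FlatCtx S A n), Le (cons as Γ') Γ := by
  obtain ⟨k, as, Γ', e, h, h'⟩ := Γ.exists_cons_equiv
  exact ⟨k, as, Γ', .of_equiv e.symm (fun i => by rw [← h, e.apply_symm_apply])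
    fun i => by rw [← h', e.apply_symm_apply]⟩

end FlatCtx

/-! ### Reducibility -/

section Reducibility

variable {S : ResourceMonad} {A : Type u} {m : ℕ}

/-- The reducible terms of type `a`. -/
def Reducible : Ty S A → Term m → Prop
  | .atom _, M => M.HeadReductionEnds
  | .arr _ as a, M => ∀ N, (∀ i, Reducible (as i) N) → Reducible a (.app M N)

/-- Head-expansion. The spine `Ns` is general because at an arrow type the induction appends one
more argument to it. -/
theorem Reducible.of_inst {a : Ty S A} {P : Term (m + 1)} {N : Term m} (Ns : List (Term m))
    (h : Reducible a (Term.apps (P.inst N) Ns)) :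
    Reducible a (Term.apps (.app (.lam P) N) Ns) := by
  induction a generalizing Ns with
  | atom o =>
    refine (Term.headReductionEnds_headReduct_iff _).1 ?_
    rwa [Term.headReduct_apps_app]
  | arr k as a _ ih =>
    intro Q hQ
    rw [← Term.apps_concat]
    refine ih _ ?_
    rw [Term.apps_concat]
    exact h Q hQ

/-- The two claims need each other at arrow types: a variable is a reducible argument by the first
claim, and the application to it terminates by the second. The parameter `x` provides that variable,
since the scope might otherwise be empty. -/
theorem reducible_of_neutral_and_ends (x : Fin m) (a : Ty S A) :
    (∀ M : Term m, M.Neutral → Reducible a M) ∧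
      ∀ M : Term m, Reducible a M → M.HeadReductionEnds := by
  induction a with
  | atom o => exact ⟨fun M h => .of_headNormal h.headNormal, fun M h => h⟩
  | arr k as a ihs ih =>
    exact ⟨fun M h N _ => ih.1 _ h,
      fun M h => .of_app_var (x := x) (ih.2 _ (h _ fun i => (ihs i).1 _ trivial))⟩

end Reducibility

/-! ### The type system -/

section Typing

variable {S : ResourceMonad} {A : Type u} [SmallCategory A] {n m : ℕ}

open FlatCtx

/-- The intersection type system whose derivable judgements are the non-empty values of the
intersection type distributors; see `typed_toFlat_iff`. -/
def Typed : {n : ℕ} → Term n → FlatCtx S A n → Ty S A → Prop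
  | _, .var i, Γ, a => Le Γ (single i a)
  | _, .lam _, _, .atom _ => False
  | _, .lam M, Γ, .arr _ as a => Typed M (cons as Γ) a
  | n, .app M N, Γ, a => ∃ (k : ℕ) (as : Fin k → Ty S A) (Γ₀ : FlatCtx S A n)
      (Γs : Fin k → FlatCtx S A n), Typed M Γ₀ (.arr k as a) ∧ (∀ i, Typed N (Γs i) (as i)) ∧
        Le Γ (tens Γ₀ (bigTens Γs))

theorem Typed.mono {M : Term n} {Γ Γ' : FlatCtx S A n} {a : Ty S A} (h : Typed M Γ a)
    (hΓ : Le Γ' Γ) : Typed M Γ' a := by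
  induction M generalizing a with
  | var i => exact hΓ.trans h
  | lam M ih =>
    cases a with
    | atom o => exact h.elim
    | arr k as a => exact ih h (hΓ.cons as)
  | app M N =>
    obtain ⟨k, as, Γ₀, Γs, hM, hN, hle⟩ := h
    exact ⟨k, as, Γ₀, Γs, hM, hN, hΓ.trans hle⟩

theorem Term.Neutral.exists_typed {M : Term n} (h : M.Neutral) (a : Ty S A) :
    ∃ Γ : FlatCtx S A n, Typed M Γ a := by
  induction M generalizing a with
  | var i => exact ⟨single i a, .refl _⟩
  | lam M => exact h.elim
  | app M N ih =>
    -- With an empty list of argument types, `N` contributes neither derivations nor declarations.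
    obtain ⟨Γ, hΓ⟩ := ih h (.arr 0 Fin.elim0 a)
    exact ⟨_, 0, Fin.elim0, Γ, fun i => i.elim0, hΓ, fun i => i.elim0, .refl _⟩

theorem Term.HeadNormal.exists_typed [Nonempty A] {M : Term n} (h : M.HeadNormal) :
    ∃ (Γ : FlatCtx S A n) (a : Ty S A), Typed M Γ a := by
  induction M with
  | var i => exact ⟨single i (.atom (Classical.arbitrary A)), .atom (Classical.arbitrary A), .refl _⟩
  | lam M ih =>
    obtain ⟨Γ, a, hM⟩ := ih h
    obtain ⟨k, as, Γ', hΓ⟩ := Γ.exists_cons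
    exact ⟨Γ', .arr k as a, hM.mono hΓ⟩
  | app M N =>
    obtain ⟨Γ, hM⟩ := Term.Neutral.exists_typed (M := .app M N) h
      (.atom (Classical.arbitrary A) : Ty S A)
    exact ⟨Γ, _, hM⟩

/-! ### Subject expansion -/

/-- `Δ` derives the declarations of `Θ`, where `V x Γ a` says that `Γ` derives `x : a`. -/
def Derives (V : Fin n → FlatCtx S A m → Ty S A → Prop) (Δ : FlatCtx S A m)
    (Θ : FlatCtx S A n) : Prop :=
  ∃ Γ : Θ.idx → FlatCtx S A m, (∀ i, V (Θ.var i) (Γ i) (Θ.ty i)) ∧ Le Δ (bigTens Γ)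

theorem Derives.mono {V : Fin n → FlatCtx S A m → Ty S A → Prop} {Δ Δ' : FlatCtx S A m}
    {Θ : FlatCtx S A n} (h : Derives V Δ Θ) (hΔ : Le Δ' Δ) : Derives V Δ' Θ := by
  obtain ⟨Γ, hΓ, hle⟩ := h
  exact ⟨Γ, hΓ, hΔ.trans hle⟩

theorem Derives.single {V : Fin n → FlatCtx S A m → Ty S A → Prop} {Δ : FlatCtx S A m}
    {x : Fin n} {a : Ty S A} (h : V x Δ a) : Derives V Δ (single x a) :=
  ⟨fun _ => Δ, fun _ => h, .of_equiv (Equiv.uniqueSigma fun _ : Unit => Δ.idx)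
    (fun _ => rfl) fun _ => rfl⟩

theorem Derives.tens {V : Fin n → FlatCtx S A m → Ty S A → Prop} {Δ Δ' : FlatCtx S A m}
    {Θ Θ' : FlatCtx S A n} (h : Derives V Δ Θ) (h' : Derives V Δ' Θ') :
    Derives V (tens Δ Δ') (tens Θ Θ') := by
  obtain ⟨Γ, hΓ, hle⟩ := h
  obtain ⟨Γ', hΓ', hle'⟩ := h'
  refine ⟨Sum.elim Γ Γ', ?_, (hle.tens hle').trans ?_⟩
  · rintro (i | i)
    exacts [hΓ i, hΓ' i]
  · refine .of_equiv (Equiv.sumSigmaDistrib _) ?_ ?_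
    all_goals rintro ⟨i | i, j⟩ <;> rfl

theorem Derives.bigTens {V : Fin n → FlatCtx S A m → Ty S A → Prop} {I : Type} [Finite I]
    {Δ : I → FlatCtx S A m} {Θ : I → FlatCtx S A n} (h : ∀ i, Derives V (Δ i) (Θ i)) :
    Derives V (bigTens Δ) (bigTens Θ) := by
  choose Γ hΓ hle using h
  exact ⟨fun x => Γ x.1 x.2, fun x => hΓ x.1 x.2, (Le.bigTens hle).trans
    (.of_equiv (Equiv.sigmaAssoc fun i j => (Γ i j).idx) (fun _ => rfl) fun _ => rfl)⟩

/-- The declarations of the variable `0` can be treated separately. -/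
theorem Derives.exists_cons {V : Fin (n + 1) → FlatCtx S A m → Ty S A → Prop} {Δ : FlatCtx S A m}
    {Θ : FlatCtx S A (n + 1)} (h : Derives V Δ Θ) :
    ∃ (k : ℕ) (as : Fin k → Ty S A) (Θ' : FlatCtx S A n) (Γ₀ : FlatCtx S A m)
      (Γs : Fin k → FlatCtx S A m), Le (cons as Θ') Θ ∧ Derives (fun x => V x.succ) Γ₀ Θ' ∧
        (∀ j, V 0 (Γs j) (as j)) ∧ Le Δ (FlatCtx.tens Γ₀ (FlatCtx.bigTens Γs)) := by
  obtain ⟨Γ, hΓ, hle⟩ := h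
  obtain ⟨k, as, Θ', e, h, h'⟩ := Θ.exists_cons_equiv
  refine ⟨k, as, Θ', FlatCtx.bigTens fun j => Γ (e (.inr j)), fun j => Γ (e (.inl j)),
    .of_equiv e.symm (fun i => by rw [← h, e.apply_symm_apply])
      (fun i => by rw [← h', e.apply_symm_apply]),
    ⟨fun j => Γ (e (.inr j)), fun j => ?_, .refl _⟩, fun j => ?_, hle.trans ?_⟩
  · exact cast (congrArg₂ (V · _ ·) (h (.inr j)) (h' (.inr j))) (hΓ (e (.inr j)))
  · exact cast (congrArg₂ (V · _ ·) (h (.inl j)) (h' (.inl j))) (hΓ (e (.inl j)))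
  · refine .of_equiv ((Equiv.sumComm _ _).trans ((Equiv.sumSigmaDistrib
      fun i : Fin k ⊕ Θ'.idx => (Γ (e i)).idx).symm.trans
        (Equiv.sigmaCongrLeft (β := fun i => (Γ i).idx) e))) ?_ ?_
    all_goals rintro (x | x) <;> rfl

/-- The extension of `V` to a new variable `0`. -/
def liftDerivation (V : Fin n → FlatCtx S A m → Ty S A → Prop) (x : Fin (n + 1))
    (Γ : FlatCtx S A (m + 1)) (a : Ty S A) : Prop :=
  Fin.cases (motive := fun _ => Prop) (Le Γ (FlatCtx.single 0 a))
    (fun y => ∃ Γ', V y Γ' a ∧ Le Γ (shift Γ')) x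

/-- Subject expansion under a binder. The list `as` is fixed by the type of the abstraction, whereas
the body may use the bound variable at another list `bs`; the comparison of `as` with `bs` is
absorbed into the context of the body. -/
theorem Derives.of_lift {V : Fin n → FlatCtx S A m → Ty S A → Prop} {Δ : FlatCtx S A m}
    {k : ℕ} {as : Fin k → Ty S A} {Θ : FlatCtx S A (n + 1)}
    (h : Derives (liftDerivation V) (cons as Δ) Θ) :
    ∃ Θ', Derives V Δ Θ' ∧ Le (cons as Θ') Θ := by
  obtain ⟨l, bs, Θ', Γ₀, Γs, hΘ, ⟨Γ, hΓ, hΓ₀⟩, hΓs, hle⟩ := h.exists_cons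
  choose Γ' hΓ' hΓ'' using hΓ
  -- Declarations of old variables come from shifted contexts and those of the bound variable from
  -- singletons at `0`, so the two groups can be separated by `Le.of_cons`.
  have h₁ : Le (cons as Δ) (cons bs (FlatCtx.bigTens Γ')) :=
    hle.trans (((hΓ₀.trans (.bigTens hΓ'')).tens (.bigTens hΓs)).trans
      (Le.cons_of_shift bs (FlatCtx.bigTens Γ')))
  exact ⟨Θ', ⟨Γ', hΓ', h₁.of_cons.1⟩, (h₁.of_cons.2 Θ').trans hΘ⟩

/-- Stated for an arbitrary `V`, as is `Typed.exists_of_lam`, so that renaming and substitution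
share the inductive cases. -/
theorem Typed.exists_of_app {V : Fin n → FlatCtx S A m → Ty S A → Prop} {M N : Term n}
    {M' N' : Term m}
    (hM : ∀ Δ a, Typed M' Δ a → ∃ Θ, Typed M Θ a ∧ Derives V Δ Θ)
    (hN : ∀ Δ a, Typed N' Δ a → ∃ Θ, Typed N Θ a ∧ Derives V Δ Θ)
    {Δ : FlatCtx S A m} {a : Ty S A} (h : Typed (.app M' N') Δ a) :
    ∃ Θ, Typed (.app M N) Θ a ∧ Derives V Δ Θ := by
  obtain ⟨k, as, Γ₀, Γs, h₀, hs, hle⟩ := h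
  obtain ⟨Θ₀, hΘ₀, hV₀⟩ := hM _ _ h₀
  choose Θs hΘs hVs using fun i => hN _ _ (hs i)
  exact ⟨FlatCtx.tens Θ₀ (FlatCtx.bigTens Θs), ⟨k, as, Θ₀, Θs, hΘ₀, hΘs, .refl _⟩,
    (hV₀.tens (.bigTens hVs)).mono hle⟩

theorem Typed.exists_of_lam {V : Fin n → FlatCtx S A m → Ty S A → Prop} {M : Term (n + 1)}
    {M' : Term (m + 1)}
    (hM : ∀ Δ a, Typed M' Δ a → ∃ Θ, Typed M Θ a ∧ Derives (liftDerivation V) Δ Θ)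
    {Δ : FlatCtx S A m} {a : Ty S A} (h : Typed (.lam M') Δ a) :
    ∃ Θ, Typed (.lam M) Θ a ∧ Derives V Δ Θ := by
  cases a with
  | atom o => exact h.elim
  | arr k as a =>
    obtain ⟨Θ, hΘ, hV⟩ := hM _ _ h
    obtain ⟨Θ', hV', hle⟩ := hV.of_lift
    exact ⟨Θ', hΘ.mono hle, hV'⟩

theorem Derives.imp {V W : Fin n → FlatCtx S A m → Ty S A → Prop} (hVW : ∀ x Γ a, V x Γ a → W x Γ a)
    {Δ : FlatCtx S A m} {Θ : FlatCtx S A n} (h : Derives V Δ Θ) : Derives W Δ Θ := by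
  obtain ⟨Γ, hΓ, hle⟩ := h
  exact ⟨Γ, fun i => hVW _ _ _ (hΓ i), hle⟩

theorem Typed.exists_of_rename (ρ : Fin n → Fin m) {M : Term n} {Δ : FlatCtx S A m} {a : Ty S A}
    (h : Typed (M.rename ρ) Δ a) :
    ∃ Θ : FlatCtx S A n, Typed M Θ a ∧ Derives (fun x Γ b => Le Γ (FlatCtx.single (ρ x) b)) Δ Θ := by
  induction M generalizing m a with
  | var i => exact ⟨_, Le.refl _, .single h⟩
  | app M N ihM ihN => exact h.exists_of_app (fun _ _ => ihM ρ) fun _ _ => ihN ρ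
  | lam M ih =>
    refine h.exists_of_lam fun Δ b hM => ?_
    obtain ⟨Θ, hΘ, hV⟩ := ih _ hM
    refine ⟨Θ, hΘ, hV.imp fun x Γ c hle => ?_⟩
    cases x using Fin.cases with
    | zero => exact hle
    | succ x => exact ⟨_, Le.refl _, hle⟩

theorem Derives.le_rename {ρ : Fin n → Fin m} {Δ : FlatCtx S A m} {Θ : FlatCtx S A n}
    (h : Derives (fun x Γ b => Le Γ (FlatCtx.single (ρ x) b)) Δ Θ) :
    Le Δ ⟨Θ.idx, fun i => ρ (Θ.var i), Θ.ty⟩ := by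
  obtain ⟨Γ, hΓ, hle⟩ := h
  exact hle.trans ((Le.bigTens hΓ).trans
    (.of_equiv (Equiv.sigmaPUnit Θ.idx).symm (fun _ => rfl) fun _ => rfl))

theorem Typed.exists_of_subst (σ : Fin n → Term m) {M : Term n} {Δ : FlatCtx S A m} {a : Ty S A}
    (h : Typed (M.subst σ) Δ a) :
    ∃ Θ : FlatCtx S A n, Typed M Θ a ∧ Derives (fun x => Typed (σ x)) Δ Θ := by
  induction M generalizing m a with
  | var i => exact ⟨_, Le.refl _, .single h⟩
  | app M N ihM ihN => exact h.exists_of_app (fun _ _ => ihM σ) fun _ _ => ihN σ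
  | lam M ih =>
    refine h.exists_of_lam fun Δ b hM => ?_
    obtain ⟨Θ, hΘ, hV⟩ := ih _ hM
    refine ⟨Θ, hΘ, hV.imp fun x Γ c hx => ?_⟩
    cases x using Fin.cases with
    | zero => exact hx
    | succ x =>
      -- A typing of the weakened term `σ x` comes from a typing of `σ x` itself in a context whose
      -- shift lies above `Γ`.
      obtain ⟨Θ', hΘ', hρ⟩ := Typed.exists_of_rename Fin.succ (M := σ x) hx
      exact ⟨Θ', hΘ', hρ.le_rename⟩

theorem Typed.of_inst {M : Term (n + 1)} {N : Term n} {Γ : FlatCtx S A n} {a : Ty S A}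
    (h : Typed (M.inst N) Γ a) : Typed (.app (.lam M) N) Γ a := by
  obtain ⟨Θ, hM, hV⟩ := h.exists_of_subst
  obtain ⟨k, as, Θ', Γ₀, Γs, hΘ, h₀, hs, hle⟩ := hV.exists_cons
  -- The variables other than `0` are substituted by themselves, and a typing of a variable is by
  -- definition an instance of `Le`.
  have h₀' : Le Γ₀ Θ' := Derives.le_rename (ρ := fun x => x) h₀
  exact ⟨k, as, Γ₀, Γs, hM.mono ((h₀'.cons as).trans hΘ), hs, hle⟩

/-- Subject expansion. -/
theorem Typed.of_beta {M N : Term n} (h : M.Beta N) {Γ : FlatCtx S A n} {a : Ty S A}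
    (hN : Typed N Γ a) : Typed M Γ a := by
  induction h generalizing a with
  | beta M N => exact hN.of_inst
  | lam h ih =>
    cases a with
    | atom o => exact hN.elim
    | arr k as a => exact ih hN
  | appLeft N h ih =>
    obtain ⟨k, as, Γ₀, Γs, h₀, hs, hle⟩ := hN
    exact ⟨k, as, Γ₀, Γs, ih h₀, hs, hle⟩
  | appRight M h ih =>
    obtain ⟨k, as, Γ₀, Γs, h₀, hs, hle⟩ := hN
    exact ⟨k, as, Γ₀, Γs, h₀, fun i => ih (hs i), hle⟩

theorem Term.HeadNormalizable.exists_typed [Nonempty A] {M : Term n} (h : M.HeadNormalizable) :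
    ∃ (Γ : FlatCtx S A n) (a : Ty S A), Typed M Γ a := by
  obtain ⟨N, hMN, hN⟩ := h
  obtain ⟨Γ, a, hN⟩ := Term.HeadNormal.exists_typed (S := S) (A := A) ((Term.isHeadNormal_iff N).1 hN)
  refine ⟨Γ, a, ?_⟩
  induction hMN using Relation.ReflTransGen.head_induction_on with
  | refl => exact hN
  | head h _ ih => exact ih.of_beta h

/-! ### Typed terms are reducible -/

/-- An argument reducible at every type of the target's list is reducible at each type of the
source's list, through the type selected by `α`. Admissibility of `α` plays no role. -/
theorem Reducible.map {a b : Ty S A} (f : Ty.Hom a b) {M : Term m} (h : Reducible a M) :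
    Reducible b M := by
  induction f generalizing M with
  | atom f => exact h
  | arr α hα f g ihf ihg => exact fun N hN => ihg (h N fun i => ihf i (hN (α i)))

theorem Typed.reducible_subst {M : Term n} {Γ : FlatCtx S A n} {a : Ty S A} (h : Typed M Γ a)
    (σ : Fin n → Term m) (hσ : ∀ i, Reducible (Γ.ty i) (σ (Γ.var i))) :
    Reducible a (M.subst σ) := by
  induction M generalizing a with
  | var i =>
    obtain ⟨α, -, hα⟩ := h
    obtain ⟨e, ⟨f⟩⟩ := hα ()
    have := (hσ (α ())).map f
    rwa [e] at this
  | lam M ih =>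
    cases a with
    | atom o => exact h.elim
    | arr k as a =>
      intro N hN
      refine Reducible.of_inst [] ?_
      change Reducible a (Term.inst _ N)
      rw [Term.inst_lift]
      refine ih h _ ?_
      rintro (i | i)
      exacts [hN i, hσ i]
  | app M N ihM ihN =>
    -- Terms can be reused freely, so only the function `α` is kept and its admissibility is
    -- dropped.
    obtain ⟨k, as, Γ₀, Γs, hM, hN, α, -, hα⟩ := h
    have hσ' : ∀ i, Reducible ((FlatCtx.tens Γ₀ (FlatCtx.bigTens Γs)).ty i)
        (σ ((FlatCtx.tens Γ₀ (FlatCtx.bigTens Γs)).var i)) := by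
      intro i
      obtain ⟨e, ⟨f⟩⟩ := hα i
      have := (hσ (α i)).map f
      rwa [e] at this
    exact ihM hM σ (fun i => hσ' (.inl i)) _ fun j => ihN (hN j) σ fun i => hσ' (.inr ⟨j, i⟩)

theorem Typed.headReductionEnds {M : Term n} {Γ : FlatCtx S A n} {a : Ty S A} (h : Typed M Γ a) :
    M.HeadReductionEnds := by
  -- Weakening by one variable guarantees that the scope has a variable, even when `M` is closed;
  -- the weakening is then undone because renaming reflects termination.
  have h := h.reducible_subst (fun i => .var i.castSucc)
    fun i => (reducible_of_neutral_and_ends (Fin.last n) _).1 _ trivial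
  rw [Term.subst_var_comp] at h
  exact (Term.headReductionEnds_rename _ _).1 ((reducible_of_neutral_and_ends (Fin.last n) a).2 _ h)

end Typing
/-! ### Non-empty values of the distributors -/

/-- If every diagonal value were empty, the universal property would give a map from the coend to
the empty type. -/
theorem nonempty_coend_iff {J : Type u} [SmallCategory J] (F : Jᵒᵖ ⥤ J ⥤ Type u) :
    Nonempty (coend F : Type u) ↔ ∃ j, Nonempty ((F.obj (op j)).obj j) := by
  constructor
  · rintro ⟨x⟩
    by_contra! h
    exact (coend.desc (F := F) (X := PEmpty.{u + 1}) (fun j => ↾fun y => (h j).elim y)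
      (fun i j f => ConcreteCategory.hom_ext _ _ fun y =>
        (h i).elim ((F.map f.op).app i y)) x).elim
  · rintro ⟨j, ⟨y⟩⟩
    exact ⟨coend.ι F j y⟩

section Flatten

variable {S : ResourceMonad} {A : Type u} [SmallCategory A] {n : ℕ}

open FlatCtx

/-! ### Comparison of type contexts with flat contexts. -/

/-- A type context as a single family of declarations. -/
def Ctx.toFlat (Δ : Ctx S (Ty S A) n) : FlatCtx S A n where
  idx := Σ x, Fin (Δ x).len
  var i := i.1
  ty i := (Δ i.1).get i.2

/-- A variable-preserving index function is a family of functions, one for each variable. By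
`of_sigmaMap` and `sigmaMap`, it is admissible exactly when every member is. -/
theorem Ctx.nonempty_hom_iff (Δ Δ' : Ctx S (Ty S A) n) :
    Nonempty (Δ ⟶ Δ') ↔ Le Δ.toFlat Δ'.toFlat := by
  constructor
  · rintro ⟨f⟩
    exact ⟨Sigma.map (fun x => x) fun x => (f x : Fam.Hom _ _).fn,
      .sigmaMap .id fun x => (f x : Fam.Hom _ _).adm,
      fun i => ⟨rfl, ⟨(f i.1 : Fam.Hom _ _).f i.2⟩⟩⟩
  · rintro ⟨α, hα, h⟩
    have h' : ∀ x (j : Fin (Δ' x).len), ∃ i : Fin (Δ x).len, α ⟨x, j⟩ = ⟨x, i⟩ := by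
      intro x j
      have e : (α ⟨x, j⟩).1 = x := (h ⟨x, j⟩).1
      generalize α ⟨x, j⟩ = y at e ⊢
      obtain ⟨y, i⟩ := y
      obtain rfl : y = x := e
      exact ⟨i, rfl⟩
    choose β hβ using h'
    obtain rfl : α = Sigma.map _root_.id β := funext fun x => hβ x.1 x.2
    exact ⟨fun x => Fam.Hom.mk (a := (Δ x).toFam) (b := (Δ' x).toFam) (β x) (hα.of_sigmaMap x)
      fun i => (h ⟨x, i⟩).2.some⟩

theorem FlatCtx.Le.of_equiv_and_symm {Γ Δ : FlatCtx S A n} (e : Δ.idx ≃ Γ.idx)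
    (h : ∀ i, Γ.var (e i) = Δ.var i) (h' : ∀ i, Γ.ty (e i) = Δ.ty i) : Le Γ Δ ∧ Le Δ Γ :=
  ⟨.of_equiv e h h', .of_equiv e.symm (fun i => by rw [← h, e.apply_symm_apply])
    fun i => by rw [← h', e.apply_symm_apply]⟩

/-- Finiteness allows the declarations of each variable to be enumerated as a list; the choice of
enumeration is invisible up to `Le` in both directions. -/
theorem FlatCtx.exists_toFlat (Γ : FlatCtx S A n) :
    ∃ Δ : Ctx S (Ty S A) n, Le Γ Δ.toFlat ∧ Le Δ.toFlat Γ := by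
  choose k e using fun x => Finite.exists_equiv_fin {i : Γ.idx // Γ.var i = x}
  let e' := fun x => (e x).some
  refine ⟨fun x => ⟨k x, fun j => Γ.ty ((e' x).symm j)⟩, Le.of_equiv_and_symm
    ((Equiv.sigmaCongrRight fun x => (e' x).symm).trans (Equiv.sigmaFiberEquiv Γ.var)) ?_ ?_⟩
  · exact fun i => ((e' i.1).symm i.2).2
  · exact fun _ => rfl

theorem Ctx.toFlat_tens {k : ℕ} (Γ₀ : Ctx S (Ty S A) n) (Γ : Fin k → Ctx S (Ty S A) n) :
    Le (Ctx.tens Γ₀ Γ).toFlat (FlatCtx.tens Γ₀.toFlat (bigTens fun i => (Γ i).toFlat)) ∧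
      Le (FlatCtx.tens Γ₀.toFlat (bigTens fun i => (Γ i).toFlat)) (Ctx.tens Γ₀ Γ).toFlat := by
  -- The flat tensor groups declarations by factor and then by variable, the componentwise tensor
  -- the other way round.
  let swap : (Σ (i : Fin k) (x : Fin n), Fin (Γ i x).len) ≃ Σ x i, Fin (Γ i x).len :=
    ⟨fun i => ⟨i.2.1, i.1, i.2.2⟩, fun i => ⟨i.2.1, i.1, i.2.2⟩, fun _ => rfl, fun _ => rfl⟩
  refine Le.of_equiv_and_symm ((Equiv.sumCongr (Equiv.refl _) swap).trans ((Equiv.sigmaSumDistrib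
      (fun x => Fin (Γ₀ x).len) fun x => Σ i, Fin (Γ i x).len).symm.trans
        (Equiv.sigmaCongrRight fun x => ResList.tensEquiv (Γ₀ x).len fun i => (Γ i x).len))) ?_ ?_
  · rintro (i | i) <;> rfl
  · rintro (i | i) <;> exact congrArg (Fam.tens _ _).get (Equiv.symm_apply_apply _ _)

theorem Ctx.toFlat_cons {k : ℕ} (as : Fin k → Ty S A) (Γ : Ctx S (Ty S A) n) :
    Le (Ctx.cons.obj (⟨k, as⟩, Γ)).toFlat (FlatCtx.cons as Γ.toFlat) ∧
      Le (FlatCtx.cons as Γ.toFlat) (Ctx.cons.obj (⟨k, as⟩, Γ)).toFlat := by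
  let f : (Fin k ⊕ Σ x, Fin (Γ x).len) → (Ctx.cons.obj (⟨k, as⟩, Γ)).toFlat.idx :=
    Sum.elim (fun i => ⟨0, i⟩) fun i => ⟨i.1.succ, i.2⟩
  have hf : Function.Bijective f := by
    constructor
    · rintro (i | ⟨x, i⟩) (j | ⟨y, j⟩) h
      · exact congrArg Sum.inl (eq_of_heq (Sigma.mk.inj h).2)
      · exact (Fin.succ_ne_zero _ (Sigma.mk.inj h).1.symm).elim
      · exact (Fin.succ_ne_zero _ (Sigma.mk.inj h).1).elim
      · obtain rfl : x = y := Fin.succ_injective _ (Sigma.mk.inj h).1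
        obtain rfl : i = j := eq_of_heq (Sigma.mk.inj h).2
        rfl
    · rintro ⟨x, i⟩
      cases x using Fin.cases with
      | zero => exact ⟨.inl i, rfl⟩
      | succ x => exact ⟨.inr ⟨x, i⟩, rfl⟩
  refine Le.of_equiv_and_symm (Equiv.ofBijective f hf) ?_ ?_
  all_goals rintro (i | i) <;> rfl

theorem Ctx.toFlat_single (x : Fin n) (a : Ty S A) :
    Le ((Ctx.single x).obj a).toFlat (FlatCtx.single x a) ∧
      Le (FlatCtx.single x a) ((Ctx.single x).obj a).toFlat := by
  have hx : ∀ i : ((Ctx.single x).obj a).toFlat.idx, i.1 = x := by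
    rintro ⟨y, i⟩
    by_contra h
    change Fin (if y = x then 1 else 0) at i
    rw [if_neg h] at i
    exact i.elim0
  let i₀ : ((Ctx.single x).obj a).toFlat.idx :=
    ⟨x, ⟨0, by change 0 < (if x = x then 1 else 0); simp⟩⟩
  have hi : ∀ i, i = i₀ := by
    rintro ⟨y, i⟩
    obtain rfl : y = x := hx ⟨y, i⟩
    refine congrArg (Sigma.mk y) (Fin.ext ?_)
    have h := i.2
    change i.1 < (if y = y then 1 else 0) at h
    rw [if_pos rfl] at h
    exact Nat.lt_one_iff.1 h
  refine Le.of_equiv_and_symm ⟨fun _ => i₀, fun _ => (), fun _ => rfl, fun i => (hi i).symm⟩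
    (fun _ => rfl) fun _ => rfl

/-- The clauses of `den` and `Typed` match one by one. Flattening commutes with the context
operations only up to `Le` in both directions, and `Typed.mono` or transitivity of `Le` absorbs the
difference. -/
theorem nonempty_den_iff (M : Term n) (Δ : Ctx S (Ty S A) n) (a : Ty S A) :
    Nonempty (((den S A M).obj a).obj (op Δ)) ↔ Typed M Δ.toFlat a := by
  induction M generalizing a with
  | var i =>
    change Nonempty (Δ ⟶ (Ctx.single i).obj a) ↔ _
    rw [Ctx.nonempty_hom_iff]
    exact ⟨fun h => h.trans (Ctx.toFlat_single i a).1, fun h => h.trans (Ctx.toFlat_single i a).2⟩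
  | lam M ih =>
    cases a with
    | atom o => exact ⟨fun ⟨x⟩ => PEmpty.elim x, fun h => h.elim⟩
    | arr k as a =>
      refine (ih (Ctx.cons.obj (⟨k, as⟩, Δ)) a).trans ?_
      exact ⟨fun h => h.mono (Ctx.toFlat_cons as Δ).2, fun h => Typed.mono (M := M) h (Ctx.toFlat_cons as Δ).1⟩
  | app M N ihM ihN =>
    change Nonempty (coend (appIntegrand (den S A M) (den S A N) a Δ) : Type u) ↔ _
    rw [nonempty_coend_iff]
    constructor
    · rintro ⟨as, h⟩
      obtain ⟨⟨Γ₀, Γs⟩, ⟨z⟩⟩ := (nonempty_coend_iff _).1 h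
      exact ⟨as.len, as.get, Γ₀.toFlat, fun i => (Γs i).toFlat, (ihM _ _).1 ⟨z.fn⟩,
        fun i => (ihN _ _).1 ⟨z.arg i⟩,
        ((Ctx.nonempty_hom_iff _ _).1 ⟨z.mor⟩).trans (Ctx.toFlat_tens _ _).1⟩
    · rintro ⟨k, as, Γ₀, Γs, hM, hN, hle⟩
      obtain ⟨Γ₀', h₀, h₀'⟩ := Γ₀.exists_toFlat
      choose Γs' hs hs' using fun i => (Γs i).exists_toFlat
      obtain ⟨fn⟩ := (ihM Γ₀' _).2 (hM.mono h₀')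
      have arg := fun i => ((ihN (Γs' i) _).2 ((hN i).mono (hs' i))).some
      obtain ⟨mor⟩ := (Ctx.nonempty_hom_iff Δ (Ctx.tens Γ₀' Γs')).2
        (hle.trans ((h₀.tens (.bigTens hs)).trans (Ctx.toFlat_tens _ _).2))
      exact ⟨⟨k, as⟩, (nonempty_coend_iff _).2 ⟨(Γ₀', Γs'), ⟨⟨fn, arg, mor⟩⟩⟩⟩

theorem not_isZeroDistributor_den_iff (M : Term n) :
    ¬ IsZeroDistributor (den S A M) ↔ ∃ (Γ : FlatCtx S A n) (a : Ty S A), Typed M Γ a := by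
  simp only [IsZeroDistributor, not_forall, not_isEmpty_iff, nonempty_den_iff]
  constructor
  · rintro ⟨Δ, a, h⟩
    exact ⟨_, a, h⟩
  · rintro ⟨Γ, a, h⟩
    obtain ⟨Δ, -, hΔ⟩ := Γ.exists_toFlat
    exact ⟨Δ, a, h.mono hΔ⟩

end Flatten

end ITD

theorem mainTheorem1 {A : Type u} [SmallCategory A] [Nonempty A] (S : ITD.ResourceMonad)
    {n : ℕ} (M : ITD.Term n) :
    List.TFAE
      [¬ ITD.IsZeroDistributor (ITD.den S A M),
        M.HeadReductionEnds,
        M.HeadNormalizable] := by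
  rw [ITD.not_isZeroDistributor_den_iff]
  tfae_have 1 → 2 := fun ⟨_, _, h⟩ => h.headReductionEnds
  tfae_have 2 → 3 := fun h => h.headNormalizable
  tfae_have 3 → 1 := fun h => h.exists_typed
  tfae_finish
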